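/- Let $\mathcal H$ be a complex Hilbert space (scalar product $(\cdot,\cdot)$ linear in the first variable), and let $H_0$ be a self-adjoint operator in $\mathcal H$ with spectral gap $(-\delta,\delta)$, $\delta>0$, i.e. $(-\delta,\delta)$ lies in the resolvent set of $H_0$. Let $P_\pm$ be the spectral projections of $H_0$ for the positive and negative half-lines, $\operatorname{sign}(H_0)=P_+-P_-$, $\mathcal Q:=\operatorname{dom}(|H_0|^{1/2})$, and $$\mathfrak h_0[u,w]:=(|H_0|^{1/2}u,\operatorname{sign}(H_0)|H_0|^{1/2}w),\qquad u,w\in\mathcal Q .$$ Let $\mathfrak v$ be a (not necessarily symmetric) sesquilinear form whose domain is a core for $|H_0|^{1/2}$ and such that $$\sup\bigl|\mathfrak v[|H_0|^{-1/2}x,|H_0|^{-1/2}y]\bigr|<1,$$ the supremum being over all unit vectors $x,y\in\mathcal H$ with $|H_0|^{-1/2}x,|H_0|^{-1/2}y\in\operatorname{dom}(\mathfrak v)$. Then $\mathfrak v$ has a unique extension to a sesquilinear form on $\mathcal Q$ that satisfies $|\mathfrak v[u,w]|\le C\,\||H_0|^{1/2}u\|\,\||H_0|^{1/2}w\|$ for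 some $C$; it is again denoted by $\mathfrak v$. Assume that $$\rho:=\sup_{x,y\in P_+\mathcal H\cup P_-\mathcal H,\ \|x\|=\|y\|=1}\bigl|\mathfrak v[|H_0|^{-1/2}x,|H_0|^{-1/2}y]\bigr|<\tfrac12$$ (with $\rho=0$ if $\mathcal H=\{0\}$). Let $\widetilde P_\pm$ be bounded, not necessarily orthogonal, projections in $\mathcal H$ with $\widetilde P_++\widetilde P_-=I$ and $$\nu:=\|P_\pm-\widetilde P_\pm\|<1,\qquad \arctan\sqrt{\tfrac{\rho}{2-3\rho}}+\arcsin\nu<\tfrac{\pi}{2}.$$ Then the following hold. (i) There exists a unique closed densely defined operator $H$ associated with the form $\mathfrak h:=\mathfrak h_0+\mathfrak v$ on $\mathcal Q$, that is, $\operatorname{dom}(H),\operatorname{dom}(H^*)\subset\mathcal Q$, $(Hu,w)=\mathfrak h[u,w]$ for $u\in\operatorname{dom}(H)$, $w\in\mathcal Q$, and $(u,H^*w)=\mathfrak h[u,w]$ for $u\in\mathcal Q$, $w\in\operatorname{dom}(H^*)$. Moreover, $\operatorname{dom}(H)$ is a core for $|H_0|^{1/2}$. (ii) There exist bounded projections $Q_\pm$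 in $\mathcal H$ with $Q_++Q_-=I$ such that $H$ is decomposed according to $\mathcal H=Q_+\mathcal H\dotplus Q_-\mathcal H$, i.e. $Q_\pm\operatorname{dom}(H)\subset\operatorname{dom}(H)$ and $HQ_\pm u=Q_\pm Hu$ for $u\in\operatorname{dom}(H)$, and $$\sigma(H|_{Q_\pm\mathcal H})=\sigma(H)\cap\{z\in\mathbb C:\pm\operatorname{Re}z>0\}.$$ (iii) These $Q_\pm$ can be chosen such that the restrictions $\widetilde P_\pm|_{Q_\pm\mathcal H}:Q_\pm\mathcal H\to\widetilde P_\pm\mathcal H$ are isomorphisms (linear homeomorphisms) and, with $X_\pm:=\widetilde P_\mp(\widetilde P_\pm|_{Q_\pm\mathcal H})^{-1}:\widetilde P_\pm\mathcal H\to\widetilde P_\mp\mathcal H$, $$Q_+\mathcal H=\{x+X_+x:x\in\widetilde P_+\mathcal H\},\qquad Q_-\mathcal H=\{y+X_-y:y\in\widetilde P_-\mathcal H\},$$ $$\|X_\pm\|\le\tan\Bigl(\arctan\sqrt{\tfrac{\rho}{2-3\rho}}+\arcsin\nu\Bigr).$$ -/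

import Mathlib

open scoped ENNReal NNReal InnerProductSpace

noncomputable section

namespace FormPert

/-! ### Unbounded operators: resolvent set, spectrum, parts, decompositions -/

section Operators

variable {X : Type*} [NormedAddCommGroup X] [NormedSpace ℂ X]

/-- `R` is a bounded two-sided inverse of `T - z : dom T → X`. -/
def IsResolventAt (T : X →ₗ.[ℂ] X) (z : ℂ) (R : X →L[ℂ] X) : Prop :=
  (∀ x : X, ∃ h : R x ∈ T.domain, T ⟨R x, h⟩ - z • R x = x) ∧
    ∀ u : T.domain, R (T u - z • (u : X)) = u

/-- The resolvent set of an unbounded operator. -/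
def resolventSet (T : X →ₗ.[ℂ] X) : Set ℂ := {z | ∃ R : X →L[ℂ] X, IsResolventAt T z R}

/-- The spectrum of an unbounded operator. -/
def spectrum (T : X →ₗ.[ℂ] X) : Set ℂ := (resolventSet T)ᶜ

open Classical in
/-- The resolvent `(T - z)⁻¹`, for `z` in the resolvent set (and `0` otherwise). -/
def resolvent (T : X →ₗ.[ℂ] X) (z : ℂ) : X →L[ℂ] X :=
  if h : ∃ R : X →L[ℂ] X, IsResolventAt T z R then h.choose else 0

/-- The part of `T` in the subspace `L`: it acts as `T` on `{x ∈ L ∩ dom T : T x ∈ L}`. -/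
def part (T : X →ₗ.[ℂ] X) (L : Submodule ℂ X) : L →ₗ.[ℂ] L where
  domain :=
    { carrier := {x | ∃ h : (x : X) ∈ T.domain, T ⟨x, h⟩ ∈ L}
      zero_mem' := ⟨T.domain.zero_mem, by
        have h0 : T ⟨((0 : L) : X), T.domain.zero_mem⟩ = 0 := T.map_zero
        rw [h0]; exact L.zero_mem⟩
      add_mem' := by
        rintro x y ⟨hx, hx'⟩ ⟨hy, hy'⟩
        refine ⟨T.domain.add_mem hx hy, ?_⟩
        have hadd := T.map_add ⟨(x : X), hx⟩ ⟨(y : X), hy⟩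
        exact hadd ▸ L.add_mem hx' hy'
      smul_mem' := by
        rintro c x ⟨hx, hx'⟩
        refine ⟨T.domain.smul_mem c hx, ?_⟩
        have hsm := T.map_smul c ⟨(x : X), hx⟩
        exact hsm ▸ L.smul_mem c hx' }
  toFun :=
    { toFun := fun x => ⟨T ⟨((x : L) : X), x.2.1⟩, x.2.2⟩
      map_add' := fun x y => Subtype.ext
        (T.map_add ⟨((x : L) : X), x.2.1⟩ ⟨((y : L) : X), y.2.1⟩)
      map_smul' := fun c x => Subtype.ext (T.map_smul c ⟨((x : L) : X), x.2.1⟩) }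

/-- A pair of complementary (bounded, not necessarily orthogonal) projections. -/
structure IsComplementaryPair (Qp Qm : X →L[ℂ] X) : Prop where
  idem_p : Qp ∘L Qp = Qp
  idem_m : Qm ∘L Qm = Qm
  add_eq : Qp + Qm = 1

/-- `Q` maps `dom T` into itself and `T Q u = Q T u` for `u ∈ dom T`. -/
def CommutesWith (T : X →ₗ.[ℂ] X) (Q : X →L[ℂ] X) : Prop :=
  ∀ u : T.domain, ∃ h : Q u ∈ T.domain, T ⟨Q u, h⟩ = Q (T u)

/-- `T` is decomposed according to the topological direct sum `X = Qp X ∔ Qm X`. -/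
def IsDecomposedBy (T : X →ₗ.[ℂ] X) (Qp Qm : X →L[ℂ] X) : Prop :=
  IsComplementaryPair Qp Qm ∧ CommutesWith T Qp ∧ CommutesWith T Qm

/-- The restriction `P|_L : L → P X` of a bounded operator `P`. -/
def restr (P : X →L[ℂ] X) (L : Submodule ℂ X) : L →L[ℂ] P.range :=
  (P ∘L L.subtypeL).codRestrict P.range fun x => ⟨(x : X), rfl⟩

end Operators

/-! ### Sesquilinear forms -/

/-- Sesquilinear forms with domain `D`, linear in the first and antilinear in the second
variable. -/
abbrev SesqForm {E : Type*} [AddCommGroup E] [Module ℂ E] (D : Submodule ℂ E) : Type _ :=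
  D →ₗ[ℂ] D →ₛₗ[starRingEnd ℂ] ℂ

section Forms

variable {E : Type*} [NormedAddCommGroup E] [InnerProductSpace ℂ E]

/-- `w` extends the form `v` from `D` to `dom A`, and it is bounded with respect to `A`.
If `v` is bounded with respect to `A` and `D` is a core of `A`, there is exactly one such `w`. -/
def IsExtension (A : E →ₗ.[ℂ] E) {D : Submodule ℂ E} (v : SesqForm D)
    (w : SesqForm A.domain) : Prop :=
  (∀ (x y : D) (hx : (x : E) ∈ A.domain) (hy : (y : E) ∈ A.domain),
      w ⟨x, hx⟩ ⟨y, hy⟩ = v x y) ∧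
    ∃ C : ℝ, ∀ x y : A.domain, ‖w x y‖ ≤ C * ‖A x‖ * ‖A y‖

open Classical in
/-- The bounded extension of the form `v` to `dom A`; see `formExt_spec`. -/
def formExt (A : E →ₗ.[ℂ] E) {D : Submodule ℂ E} (v : SesqForm D) : SesqForm A.domain :=
  if h : ∃ w : SesqForm A.domain, IsExtension A v w then h.choose else 0

theorem mem_closure_of_hasCore {A : E →ₗ.[ℂ] E} {D : Submodule ℂ E} (hD : A.HasCore D)
    (x : A.domain) :
    A x ∈ (LinearMap.range (A.toFun ∘ₗ Submodule.inclusion hD.le_domain)).topologicalClosure := by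
  have hsub : ∀ p ∈ (A.domRestrict D).graph,
      p.2 ∈ LinearMap.range (A.toFun ∘ₗ Submodule.inclusion hD.le_domain) := by
    intro p hp
    obtain ⟨y, hy1, hy2⟩ := (LinearPMap.mem_graph_iff _).1 hp
    have hyD : (y : E) ∈ D := y.2.1
    refine ⟨⟨(y : E), hyD⟩, ?_⟩
    rw [← hy2]
    have h : A.domRestrict D y = A ⟨(y : E), hD.le_domain hyD⟩ := LinearPMap.domRestrict_apply rfl
    exact h.symm
  have hx : ((x : E), A x) ∈ (A.domRestrict D).closure.graph := by
    rw [hD.closure_eq]; exact A.mem_graph x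
  by_cases hc : (A.domRestrict D).IsClosable
  · rw [← hc.graph_closure_eq_closure_graph] at hx
    have h1 : A x ∈ closure (Prod.snd '' ((A.domRestrict D).graph : Set (E × E))) :=
      image_closure_subset_closure_image continuous_snd ⟨_, hx, rfl⟩
    refine closure_mono ?_ h1
    rintro _ ⟨p, hp, rfl⟩
    exact hsub p hp
  · rw [LinearPMap.closure_def' hc] at hx
    exact subset_closure (hsub _ hx)

theorem exists_bounded_extension {V K : Type*} [AddCommGroup V] [Module ℂ V]
    [NormedAddCommGroup K] [NormedSpace ℂ K] (e : V →ₗ[ℂ] K) (he : DenseRange e)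
    (v : V →ₗ[ℂ] V →ₛₗ[starRingEnd ℂ] ℂ) (C : ℝ) (hv : ∀ x y, ‖v x y‖ ≤ C * ‖e x‖ * ‖e y‖) :
    ∃ B : K →L[ℂ] K →SL[starRingEnd ℂ] ℂ, ∀ x y, B (e x) (e y) = v x y := by
  have hex : ∀ x y, (v x).extendOfNorm e (e y) = v x y := fun x y =>
    LinearMap.extendOfNorm_eq he ⟨_, hv x⟩ y
  let g : V →ₗ[ℂ] (K →SL[starRingEnd ℂ] ℂ) :=
    { toFun := fun x => (v x).extendOfNorm e
      map_add' := fun x y => by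
        ext z
        refine congrFun (he.equalizer (ContinuousLinearMap.continuous _)
          (ContinuousLinearMap.continuous _) ?_) z
        funext d
        have h := hex (x + y) d
        rw [map_add] at h
        simpa [hex] using h
      map_smul' := fun c x => by
        ext z
        refine congrFun (he.equalizer (ContinuousLinearMap.continuous _)
          (ContinuousLinearMap.continuous _) ?_) z
        funext d
        have h := hex (c • x) d
        rw [map_smul] at h
        simpa [hex] using h }
  have hg : ∀ x, ‖g x‖ ≤ |C| * ‖e x‖ := fun x => by
    refine LinearMap.opNorm_extendOfNorm_le he (by positivity) fun y => (hv x y).trans ?_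
    gcongr
    exact le_abs_self C
  refine ⟨g.extendOfNorm e, fun x y => ?_⟩
  rw [LinearMap.extendOfNorm_eq he ⟨_, hg⟩ x]
  exact hex x y

/-- The extension exists, so that `formExt` is never the default value for the forms at hand. -/
theorem formExt_spec {A : E →ₗ.[ℂ] E} {D : Submodule ℂ E} (hD : A.HasCore D) (v : SesqForm D)
    (C : ℝ) (hv : ∀ x y : D, ‖v x y‖ ≤
      C * ‖A ⟨x, hD.le_domain x.2⟩‖ * ‖A ⟨y, hD.le_domain y.2⟩‖) :
    IsExtension A v (formExt A v) := by
  have key : ∃ w : SesqForm A.domain, IsExtension A v w := by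
    let K := LinearMap.range (A.toFun ∘ₗ Submodule.inclusion hD.le_domain)
    let j : A.domain →ₗ[ℂ] K.topologicalClosure :=
      A.toFun.codRestrict _ fun x => mem_closure_of_hasCore hD x
    let e : D →ₗ[ℂ] K.topologicalClosure := j ∘ₗ Submodule.inclusion hD.le_domain
    have he : DenseRange e := by
      intro z
      rw [closure_subtype]
      refine closure_mono ?_ z.2
      rintro _ ⟨d, rfl⟩
      exact ⟨e d, ⟨d, rfl⟩, rfl⟩
    obtain ⟨B, hB⟩ := exists_bounded_extension e he v C hv
    exact ⟨LinearMap.mk₂'ₛₗ (RingHom.id ℂ) (starRingEnd ℂ) (fun x y => B (j x) (j y))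
      (by intros; simp) (by intros; simp) (by intros; simp) (by intros; simp),
      fun x y _ _ => hB x y, ‖B‖, fun x y => B.le_opNorm₂ (j x) (j y)⟩
  rw [formExt, dif_pos key]
  exact key.choose_spec

variable [CompleteSpace E]

/-- The closed densely defined operator `T` is associated with the form `h` with domain `Q`. The
scalar product of the Hilbert space, linear in the first variable, is `(x, y) = ⟪y, x⟫_ℂ`. -/
structure IsAssociated (T : E →ₗ.[ℂ] E) {Q : Submodule ℂ E} (h : SesqForm Q) : Prop where
  closed : T.IsClosed
  dense : Dense (T.domain : Set E)
  dom_le : T.domain ≤ Q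
  adjoint_dom_le : T.adjoint.domain ≤ Q
  eq_left : ∀ (u : T.domain) (w : Q), ⟪(w : E), T u⟫_ℂ = h ⟨u, dom_le u.2⟩ w
  eq_right : ∀ (u : Q) (w : T.adjoint.domain),
    ⟪T.adjoint w, (u : E)⟫_ℂ = h u ⟨w, adjoint_dom_le w.2⟩

/-! ### Functions of a self-adjoint operator with a spectral gap at zero

For a self-adjoint operator `H₀` with `0` in its resolvent set, functions of `H₀` are expressed as
functions of the bounded self-adjoint injective operator `R = H₀⁻¹`. -/

/-- The bounded operator `|H₀|^{-1/2}`, that is `|R|^{1/2}` for `R = H₀⁻¹`. -/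
def absInvSqrt (H₀ : E →ₗ.[ℂ] E) : E →L[ℂ] E := CFC.sqrt (CFC.abs (resolvent H₀ 0))

/-- The operator `|H₀|^{1/2}`, the (unbounded) inverse of `|H₀|^{-1/2}`. -/
def absSqrt (H₀ : E →ₗ.[ℂ] E) : E →ₗ.[ℂ] E :=
  ((absInvSqrt H₀ : E →ₗ[ℂ] E).toPMap ⊤).inverse

/-- The spectral projection `P₊` of `H₀` for the positive half-line. Since `R = H₀⁻¹` is injective,
its spectral subspace for `(0, ∞)` is the subspace where `|R| = R`. -/
def posProj (H₀ : E →ₗ.[ℂ] E) : E →L[ℂ] E :=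
  (CFC.abs (resolvent H₀ 0) - resolvent H₀ 0).ker.starProjection

/-- The spectral projection `P₋` of `H₀` for the negative half-line: the complementary projection
of `P₊`, because `0` is not in the spectrum of `H₀`. -/
def negProj (H₀ : E →ₗ.[ℂ] E) : E →L[ℂ] E := 1 - posProj H₀

/-- The operator `sign H₀ = P₊ - P₋`. -/
def signOp (H₀ : E →ₗ.[ℂ] E) : E →L[ℂ] E := posProj H₀ - negProj H₀

/-- The form represented by `H₀`:
`𝔥₀[u, w] = (|H₀|^{1/2} u, sign(H₀) |H₀|^{1/2} w)` on `dom |H₀|^{1/2}`. -/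
def freeForm (H₀ : E →ₗ.[ℂ] E) : SesqForm (absSqrt H₀).domain :=
  LinearMap.mk₂'ₛₗ (RingHom.id ℂ) (starRingEnd ℂ)
    (fun u w => ⟪signOp H₀ (absSqrt H₀ w), absSqrt H₀ u⟫_ℂ)
    (by intros; simp [LinearPMap.map_add])
    (by intros; simp [LinearPMap.map_smul])
    (by intros; simp [LinearPMap.map_add])
    (by intros; simp [LinearPMap.map_smul, mul_comm])

/-- The supremum of `|v[|H₀|^{-1/2} x, |H₀|^{-1/2} y]|` over the unit vectors `x, y ∈ M` (for which
the form is defined), as an extended nonnegative number. -/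
def formSup (H₀ : E →ₗ.[ℂ] E) {D : Submodule ℂ E} (v : SesqForm D) (M : Set E) : ℝ≥0∞ :=
  ⨆ (x : E) (y : E) (_ : x ∈ M) (_ : y ∈ M) (_ : ‖x‖ = 1) (_ : ‖y‖ = 1)
    (hx : absInvSqrt H₀ x ∈ D) (hy : absInvSqrt H₀ y ∈ D),
    ‖v ⟨absInvSqrt H₀ x, hx⟩ ⟨absInvSqrt H₀ y, hy⟩‖ₑ

end Forms

end FormPert

end

noncomputable section

namespace FormPert

open Polynomial

/-! Write A = |H₀|^{-1/2}, P = P₊, J = 2P - 1. In the variable |H₀|^{1/2}u the form 𝔳 becomes a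
bounded operator V and 𝔥 becomes B = J + V (`formOp`), so H must be the inverse of S = A B⁻¹ A
(`assocInv`). The bounds on the four blocks of V give Re⟨Jy, By⟩ ≥ (1 - 2ρ)‖y‖². Hence B is
invertible. As A commutes with J, adding an imaginary multiple of A² to B leaves this real part
unchanged, so the imaginary axis lies in the resolvent set of H.

The projections are Q± = (1 ± G)/2 with G = sign S, and the main point is that G is bounded
(`exists_bounded_sign`). The functions tanh(2ⁿ artanh S + iα) are averages of Möbius transforms of
S; multiplied by S² they converge geometrically to Γ = sign(S) S². With s = √(ρ/(2 - 3ρ)), the block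
bounds make S accretive for the two indefinite weights s²P - (1 - P) and P - s²(1 - P). Möbius
transforms, averages and limits preserve this, which forces the vectors on which Γ acts as S² or as
-S² into opposite cones of slope s < 1. Such cones are uniformly separated, so S⁴y ↦ S²Γy is bounded
and extends to G.

Geometrically, Q₊ℋ lies within the angle arctan s of P₊ℋ, while P̃₊ deviates from P₊ by the angle
arcsin ν; the angles add (`norm_sub_le_tan`). Coercivity of J + G and a Neumann series make the
restriction of P̃₊ to Q₊ℋ onto, and Q₋ is the same statement for -G and 1 - P. The half-planes come
from the symmetric operator J + G*JG, whose product with G is a positive form (`isUnit_sub_smul`).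
-/

theorem commute_ringInverse {M : Type*} [MonoidWithZero M] {a b : M} (h : Commute a b) : Commute a (Ring.inverse b) := by
  by_cases hb : IsUnit b
  · obtain ⟨u, rfl⟩ := hb
    rw [Ring.inverse_unit]
    exact h.units_inv_right
  · rw [Ring.inverse_non_unit _ hb]
    exact Commute.zero_right a

/-! ### Part: the regularized sign of an algebra element as a limit of averaged Möbius transforms.
-/

section DyadicCalculus

variable {R : Type*} [NormedRing R] [NormedAlgebra ℂ R]

/-- The element `cos α + i sin α S`. -/
def cayleyDen (S : R) (α : ℝ) : R := (Real.cos α : ℂ) • 1 + (Real.sin α * Complex.I) • S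

/-- The Möbius transform `tanh (artanh S + i α)` of `S`. -/
def cayley (S : R) (α : ℝ) : R :=
  ((Real.cos α : ℂ) • S + (Real.sin α * Complex.I) • 1) * Ring.inverse (cayleyDen S α)

/-- The function `tanh (2 ^ n * artanh S + i α)` of `S`, as a mean of Möbius transforms. -/
def dyadicTanh (S : R) : ℕ → ℝ → R
  | 0, α => cayley S α
  | n + 1, α =>
    (1 / 2 : ℂ) • (dyadicTanh S n (α / 2 + Real.pi / 4) + dyadicTanh S n (α / 2 - Real.pi / 4))

/-- The denominator of `dyadicTanh`. -/
def tanhDen (n : ℕ) (α : ℝ) : ℂ[X] :=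
  C (Complex.exp (α * Complex.I)) * (1 + X) ^ 2 ^ n +
    C (Complex.exp (-(α * Complex.I))) * (1 - X) ^ 2 ^ n

/-- The numerator of `dyadicTanh`. -/
def tanhNum (n : ℕ) (α : ℝ) : ℂ[X] :=
  C (Complex.exp (α * Complex.I)) * (1 + X) ^ 2 ^ n -
    C (Complex.exp (-(α * Complex.I))) * (1 - X) ^ 2 ^ n

theorem exp_pi_div_four_sq : Complex.exp ((Real.pi / 4 : ℂ) * Complex.I) ^ 2 = Complex.I := by
  have h : ((2 : ℕ) : ℂ) * ((Real.pi / 4 : ℂ) * Complex.I) = Real.pi / 2 * Complex.I := by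
    push_cast
    ring
  rw [← Complex.exp_nat_mul, h, Complex.exp_pi_div_two_mul_I]

theorem exp_neg_pi_div_four_sq :
    Complex.exp (-((Real.pi / 4 : ℂ) * Complex.I)) ^ 2 = -Complex.I := by
  rw [Complex.exp_neg, inv_pow, exp_pi_div_four_sq, Complex.inv_I]

theorem exp_angle_double (α : ℝ) :
    Complex.exp (α * Complex.I) = Complex.exp ((α / 2 : ℂ) * Complex.I) ^ 2 ∧
    Complex.exp (-(α * Complex.I)) = Complex.exp (-((α / 2 : ℂ) * Complex.I)) ^ 2 ∧
    Complex.exp (((α / 2 + Real.pi / 4 : ℝ) : ℂ) * Complex.I) =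
      Complex.exp ((α / 2 : ℂ) * Complex.I) * Complex.exp ((Real.pi / 4 : ℂ) * Complex.I) ∧
    Complex.exp (-(((α / 2 + Real.pi / 4 : ℝ) : ℂ) * Complex.I)) =
      Complex.exp (-((α / 2 : ℂ) * Complex.I)) * Complex.exp (-((Real.pi / 4 : ℂ) * Complex.I)) ∧
    Complex.exp (((α / 2 - Real.pi / 4 : ℝ) : ℂ) * Complex.I) =
      Complex.exp ((α / 2 : ℂ) * Complex.I) * Complex.exp (-((Real.pi / 4 : ℂ) * Complex.I)) ∧
    Complex.exp (-(((α / 2 - Real.pi / 4 : ℝ) : ℂ) * Complex.I)) =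
      Complex.exp (-((α / 2 : ℂ) * Complex.I)) * Complex.exp ((Real.pi / 4 : ℂ) * Complex.I) := by
  refine ⟨?_, ?_, ?_, ?_, ?_, ?_⟩
  · rw [← Complex.exp_nat_mul]; congr 1; push_cast; ring
  · rw [← Complex.exp_nat_mul]; congr 1; push_cast; ring
  all_goals rw [← Complex.exp_add]; congr 1; push_cast; ring

theorem exp_quarter_relations :
    (C (Complex.exp ((Real.pi / 4 : ℂ) * Complex.I)) : ℂ[X]) ^ 2 +
      C (Complex.exp (-((Real.pi / 4 : ℂ) * Complex.I))) ^ 2 = 0 ∧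
    (C (Complex.exp ((Real.pi / 4 : ℂ) * Complex.I)) : ℂ[X]) *
      C (Complex.exp (-((Real.pi / 4 : ℂ) * Complex.I))) = 1 := by
  constructor
  · rw [← C_pow, ← C_pow, ← C_add, exp_pi_div_four_sq, exp_neg_pi_div_four_sq]; simp
  · rw [← C_mul, ← Complex.exp_add]; simp

/-- This is cosh 2z = 2 cosh(z + iπ/4) cosh(z - iπ/4), cleared of denominators. Working in ℂ[X]
keeps the identities commutative; they are evaluated at S afterwards. -/
theorem tanhDen_succ (n : ℕ) (α : ℝ) :
    tanhDen (n + 1) α =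
      tanhDen n (α / 2 + Real.pi / 4) * tanhDen n (α / 2 - Real.pi / 4) := by
  obtain ⟨h1, h2, h3, h4, h5, h6⟩ := exp_angle_double α
  obtain ⟨hw, hw'⟩ := exp_quarter_relations
  simp only [tanhDen, h1, h2, h3, h4, h5, h6, C_mul, C_pow, pow_succ 2 n, pow_mul]
  linear_combination (exp := 1) (-(C (Complex.exp ((α / 2 : ℂ) * Complex.I)) ^ 2 *
      ((1 + X) ^ 2 ^ n) ^ 2 + C (Complex.exp (-((α / 2 : ℂ) * Complex.I))) ^ 2 *
      ((1 - X) ^ 2 ^ n) ^ 2)) * hw' - (C (Complex.exp ((α / 2 : ℂ) * Complex.I)) *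
      C (Complex.exp (-((α / 2 : ℂ) * Complex.I))) * (1 + X) ^ 2 ^ n * (1 - X) ^ 2 ^ n) * hw

/-- The identity 2 tanh 2z = tanh(z + iπ/4) + tanh(z - iπ/4); it is why `dyadicTanh` is an average.
-/
theorem tanhNum_succ (n : ℕ) (α : ℝ) :
    2 * tanhNum (n + 1) α =
      tanhNum n (α / 2 + Real.pi / 4) * tanhDen n (α / 2 - Real.pi / 4) +
        tanhNum n (α / 2 - Real.pi / 4) * tanhDen n (α / 2 + Real.pi / 4) := by
  obtain ⟨h1, h2, h3, h4, h5, h6⟩ := exp_angle_double α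
  obtain ⟨hw, hw'⟩ := exp_quarter_relations
  simp only [tanhDen, tanhNum, h1, h2, h3, h4, h5, h6, C_mul, C_pow, pow_succ 2 n, pow_mul]
  linear_combination (exp := 1) (-2 * (C (Complex.exp ((α / 2 : ℂ) * Complex.I)) ^ 2 *
      ((1 + X) ^ 2 ^ n) ^ 2 - C (Complex.exp (-((α / 2 : ℂ) * Complex.I))) ^ 2 *
      ((1 - X) ^ 2 ^ n) ^ 2)) * hw'

/-- Since tanh(z + iπ/4) tanh(z - iπ/4) = 1; this is the origin of G² = 1. -/
theorem tanhNum_mul_tanhNum (n : ℕ) :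
    tanhNum n (Real.pi / 4) * tanhNum n (-(Real.pi / 4)) =
      tanhDen n (Real.pi / 4) * tanhDen n (-(Real.pi / 4)) := by
  obtain ⟨hw, hw'⟩ := exp_quarter_relations
  simp only [tanhDen, tanhNum]
  push_cast
  simp only [neg_mul, neg_neg]
  linear_combination (exp := 1) (-2 * (1 + X) ^ 2 ^ n * (1 - X) ^ 2 ^ n) * hw

/-- The recursion must avoid zeros of the cosine: there `cayleyDen` is a multiple of S, which need
not be invertible. -/
theorem cos_half_add_ne_zero {α : ℝ} (h : Real.cos α ≠ 0) :
    Real.cos (α / 2 + Real.pi / 4) ≠ 0 ∧ Real.cos (α / 2 - Real.pi / 4) ≠ 0 := by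
  have key : 2 * Real.cos (α / 2 + Real.pi / 4) * Real.cos (α / 2 - Real.pi / 4) = Real.cos α := by
    rw [Real.two_mul_cos_mul_cos]
    have h1 : α / 2 + Real.pi / 4 - (α / 2 - Real.pi / 4) = Real.pi / 2 := by ring
    have h2 : α / 2 + Real.pi / 4 + (α / 2 - Real.pi / 4) = α := by ring
    rw [h1, h2, Real.cos_pi_div_two, zero_add]
  constructor <;> intro h0 <;> rw [h0] at key <;> simp at key <;> exact h key.symm

variable {S : R}

theorem aeval_tanhDen_zero (α : ℝ) : aeval S (tanhDen 0 α) = (2 : ℂ) • cayleyDen S α := by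
  simp only [tanhDen, cayleyDen, pow_zero, pow_one, map_add, map_sub, map_mul, aeval_C, map_one,
    aeval_X, Algebra.algebraMap_eq_smul_one, smul_mul_assoc, one_mul]
  rw [← neg_mul, Complex.exp_mul_I, Complex.exp_mul_I, Complex.cos_neg, Complex.sin_neg]
  push_cast
  module

theorem aeval_tanhNum_zero (α : ℝ) : aeval S (tanhNum 0 α) =
    (2 : ℂ) • ((Real.cos α : ℂ) • S + (Real.sin α * Complex.I) • 1) := by
  simp only [tanhNum, pow_zero, pow_one, map_add, map_sub, map_mul, aeval_C, map_one,
    aeval_X, Algebra.algebraMap_eq_smul_one, smul_mul_assoc, one_mul]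
  rw [← neg_mul, Complex.exp_mul_I, Complex.exp_mul_I, Complex.cos_neg, Complex.sin_neg]
  push_cast
  module

theorem commute_dyadicTanh {T : R} (hT : Commute T S) (n : ℕ) : ∀ α : ℝ,
    Commute T (dyadicTanh S n α) := by
  induction n with
  | zero =>
    intro α
    have h1 : Commute T (cayleyDen S α) :=
      ((Commute.one_right T).smul_right _).add_right (hT.smul_right _)
    exact ((hT.smul_right _).add_right ((Commute.one_right T).smul_right _)).mul_right
      (commute_ringInverse h1)
  | succ n ih =>
    intro α
    exact ((ih _).add_right (ih _)).smul_right _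

section Units

variable (hS : ∀ α : ℝ, Real.cos α ≠ 0 → IsUnit (cayleyDen S α))

include hS

theorem isUnit_aeval_tanhDen (n : ℕ) : ∀ α : ℝ, Real.cos α ≠ 0 →
    IsUnit (aeval S (tanhDen n α)) := by
  induction n with
  | zero =>
    intro α h
    rw [aeval_tanhDen_zero]
    exact (hS α h).smul (Units.mk0 (2 : ℂ) two_ne_zero)
  | succ n ih =>
    intro α h
    rw [tanhDen_succ, map_mul]
    exact (ih _ (cos_half_add_ne_zero h).1).mul (ih _ (cos_half_add_ne_zero h).2)

theorem dyadicTanh_mul_den (n : ℕ) : ∀ α : ℝ, Real.cos α ≠ 0 →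
    dyadicTanh S n α * aeval S (tanhDen n α) = aeval S (tanhNum n α) := by
  induction n with
  | zero =>
    intro α h
    rw [aeval_tanhDen_zero, aeval_tanhNum_zero, dyadicTanh, cayley, mul_smul_comm,
      Ring.inverse_mul_cancel_right _ _ (hS α h)]
  | succ n ih =>
    intro α h
    have h1 := ih _ (cos_half_add_ne_zero h).1
    have h2 := ih _ (cos_half_add_ne_zero h).2
    have h3 := congrArg (aeval S) (tanhNum_succ n α)
    simp only [map_mul, map_add, ← h1, ← h2, mul_assoc] at h3
    have hc : aeval S (tanhDen n (α / 2 - Real.pi / 4)) *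
        aeval S (tanhDen n (α / 2 + Real.pi / 4)) = aeval S (tanhDen n (α / 2 + Real.pi / 4)) *
        aeval S (tanhDen n (α / 2 - Real.pi / 4)) := by
      rw [← map_mul, mul_comm, map_mul]
    rw [hc, ← add_mul] at h3
    rw [dyadicTanh, tanhDen_succ, map_mul, smul_mul_assoc, ← h3, map_ofNat, two_mul, ← two_smul ℂ, smul_smul]
    norm_num

theorem dyadicTanh_mul_dyadicTanh (n : ℕ) :
    dyadicTanh S n (Real.pi / 4) * dyadicTanh S n (-(Real.pi / 4)) = 1 := by
  have hp : Real.cos (Real.pi / 4) ≠ 0 := by rw [Real.cos_pi_div_four]; positivity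
  have hm : Real.cos (-(Real.pi / 4)) ≠ 0 := by rwa [Real.cos_neg]
  have h1 := dyadicTanh_mul_den hS n _ hp
  have h2 := dyadicTanh_mul_den hS n _ hm
  have hu := (isUnit_aeval_tanhDen hS n _ hp).mul (isUnit_aeval_tanhDen hS n _ hm)
  have h3 := congrArg (aeval S) (tanhNum_mul_tanhNum n)
  have hc : Commute (aeval S (tanhDen n (Real.pi / 4))) (dyadicTanh S n (-(Real.pi / 4))) := by
    refine commute_dyadicTanh ?_ n _
    have := congrArg (aeval S) (mul_comm (tanhDen n (Real.pi / 4)) X)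
    simpa [Commute, SemiconjBy] using this
  rw [map_mul, map_mul, ← h1, ← h2] at h3
  refine hu.mul_right_cancel ?_
  rw [one_mul]
  refine Eq.trans ?_ h3
  rw [mul_assoc, mul_assoc, ← mul_assoc (aeval S (tanhDen n (Real.pi / 4))), hc.eq, mul_assoc]

variable {κ : ℝ} (hκ : ∀ α : ℝ, Real.cos α ≠ 0 → ‖S * Ring.inverse (cayleyDen S α)‖ ≤ κ)

include hκ

/-- The subtraction formula for tanh leaves both denominators. The factor S² supplies one S to each,
and S times an inverse denominator is what κ controls uniformly. -/
theorem norm_cayley_sub_le {α β : ℝ} (hα : Real.cos α ≠ 0) (hβ : Real.cos β ≠ 0) :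
    ‖cayley S α * S ^ 2 - cayley S β * S ^ 2‖ ≤ ‖1 - S ^ 2‖ * κ ^ 2 * |α - β| := by
  have hκ0 : 0 ≤ κ := (norm_nonneg _).trans (hκ α hα)
  have key : cayley S α * S ^ 2 - cayley S β * S ^ 2 =
      ((Real.sin (α - β) * Complex.I) • (1 - S ^ 2)) *
        ((S * Ring.inverse (cayleyDen S α)) * (S * Ring.inverse (cayleyDen S β))) := by
    obtain ⟨u, hu⟩ := hS α hα
    obtain ⟨w, hw⟩ := hS β hβ
    have hSu : Commute S (cayleyDen S α) :=
      ((Commute.one_right S).smul_right _).add_right ((Commute.refl S).smul_right _)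
    have hSw : Commute S (cayleyDen S β) :=
      ((Commute.one_right S).smul_right _).add_right ((Commute.refl S).smul_right _)
    have huw : Commute (cayleyDen S α) (cayleyDen S β) :=
      ((Commute.one_left _).smul_left _).add_left (hSw.smul_left _)
    have hnum : Commute ((Real.cos β : ℂ) • S + (Real.sin β * Complex.I) • (1 : R))
        (cayleyDen S α) := (hSu.smul_left _).add_left ((Commute.one_left _).smul_left _)
    rw [← hu] at hSu huw hnum
    rw [← hw] at hSw huw
    have e : ((Real.cos α : ℂ) • S + (Real.sin α * Complex.I) • (1 : R)) * w -
        ((Real.cos β : ℂ) • S + (Real.sin β * Complex.I) • (1 : R)) * u =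
          (Real.sin (α - β) * Complex.I) • (1 - S ^ 2) := by
      rw [hu, hw, cayleyDen, cayleyDen, Real.sin_sub]
      simp only [add_mul, mul_add, smul_mul_assoc, mul_smul_comm, one_mul, mul_one, smul_add,
        smul_smul, smul_sub, pow_two]
      push_cast
      module
    have cu : Commute S ↑u⁻¹ := hSu.units_inv_right
    have cw : Commute S ↑w⁻¹ := hSw.units_inv_right
    have cuw : Commute (u : R) ↑w⁻¹ := huw.units_inv_right
    have cuw' : Commute (↑u⁻¹ : R) ↑w⁻¹ := cuw.units_inv_left
    have cwu : Commute (w : R) ↑u⁻¹ := huw.symm.units_inv_right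
    rw [cayley, cayley, ← hu, ← hw, Ring.inverse_unit, Ring.inverse_unit, ← e]
    have e1 : (S * (↑u⁻¹ : R)) * (S * ↑w⁻¹) = ↑u⁻¹ * ↑w⁻¹ * S ^ 2 := by
      rw [cu.eq, cw.eq, mul_assoc, ← mul_assoc S, cw.eq, pow_two]
      simp only [mul_assoc]
    have e2 : (w : R) * (↑u⁻¹ * ↑w⁻¹) = ↑u⁻¹ := by rw [cuw'.eq]; simp
    have e3 : (u : R) * (↑u⁻¹ * ↑w⁻¹) = ↑w⁻¹ := by simp
    rw [e1, ← mul_assoc, sub_mul, mul_assoc _ (w : R), mul_assoc _ (u : R), e2, e3, sub_mul]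
  rw [key]
  refine (norm_mul_le _ _).trans ?_
  have h1 : ‖((Real.sin (α - β) * Complex.I) • (1 - S ^ 2) : R)‖ ≤ |α - β| * ‖1 - S ^ 2‖ := by
    rw [norm_smul]
    refine mul_le_mul ?_ ?_ (norm_nonneg _) (abs_nonneg _)
    · rw [norm_mul, Complex.norm_I, mul_one, Complex.norm_real]
      exact Real.abs_sin_le_abs
    · exact le_rfl
  have h2 : ‖(S * Ring.inverse (cayleyDen S α)) * (S * Ring.inverse (cayleyDen S β))‖ ≤ κ ^ 2 := by
    refine (norm_mul_le _ _).trans ?_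
    rw [pow_two]
    exact mul_le_mul (hκ α hα) (hκ β hβ) (norm_nonneg _) hκ0
  calc _ ≤ |α - β| * ‖1 - S ^ 2‖ * κ ^ 2 := by gcongr
    _ = _ := by ring

/-- Each averaging step halves the difference of the angles, hence also the Lipschitz constant. -/
theorem norm_dyadicTanh_sub_le (n : ℕ) : ∀ {α β : ℝ}, Real.cos α ≠ 0 →
    Real.cos β ≠ 0 → ‖dyadicTanh S n α * S ^ 2 - dyadicTanh S n β * S ^ 2‖ ≤
      ‖1 - S ^ 2‖ * κ ^ 2 * (1 / 2) ^ n * |α - β| := by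
  induction n with
  | zero =>
    intro α β hα hβ
    simpa [dyadicTanh] using norm_cayley_sub_le hS hκ hα hβ
  | succ n ih =>
    intro α β hα hβ
    have h1 := ih (cos_half_add_ne_zero hα).1 (cos_half_add_ne_zero hβ).1
    have h2 := ih (cos_half_add_ne_zero hα).2 (cos_half_add_ne_zero hβ).2
    have e1 : |α / 2 + Real.pi / 4 - (β / 2 + Real.pi / 4)| = 1 / 2 * |α - β| := by
      rw [show α / 2 + Real.pi / 4 - (β / 2 + Real.pi / 4) = 1 / 2 * (α - β) by ring, abs_mul]
      norm_num
    have e2 : |α / 2 - Real.pi / 4 - (β / 2 - Real.pi / 4)| = 1 / 2 * |α - β| := by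
      rw [show α / 2 - Real.pi / 4 - (β / 2 - Real.pi / 4) = 1 / 2 * (α - β) by ring, abs_mul]
      norm_num
    rw [e1] at h1
    rw [e2] at h2
    have e : dyadicTanh S (n + 1) α * S ^ 2 - dyadicTanh S (n + 1) β * S ^ 2 = (1 / 2 : ℂ) •
        ((dyadicTanh S n (α / 2 + Real.pi / 4) * S ^ 2 -
          dyadicTanh S n (β / 2 + Real.pi / 4) * S ^ 2) +
        (dyadicTanh S n (α / 2 - Real.pi / 4) * S ^ 2 -
          dyadicTanh S n (β / 2 - Real.pi / 4) * S ^ 2)) := by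
      simp only [dyadicTanh, smul_mul_assoc, add_mul]
      module
    rw [e, norm_smul, pow_succ _ n]
    have e3 : ‖(1 / 2 : ℂ)‖ = 1 / 2 := by norm_num
    rw [e3]
    have := norm_add_le (dyadicTanh S n (α / 2 + Real.pi / 4) * S ^ 2 -
          dyadicTanh S n (β / 2 + Real.pi / 4) * S ^ 2) (dyadicTanh S n (α / 2 - Real.pi / 4) * S ^ 2 -
          dyadicTanh S n (β / 2 - Real.pi / 4) * S ^ 2)
    linarith

open Filter Topology in
/-- The regularized sign `sign(S) S²` of an element with spectrum off the imaginary axis. -/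
theorem exists_tendsto_dyadicTanh [CompleteSpace R] :
    ∃ Γ : R, Tendsto (fun n => dyadicTanh S n 0 * S ^ 2) atTop (𝓝 Γ) ∧
      Commute S Γ ∧ Γ * Γ = S ^ 4 := by
  have hp : Real.cos (Real.pi / 4) ≠ 0 := by rw [Real.cos_pi_div_four]; positivity
  have hm : Real.cos (-(Real.pi / 4)) ≠ 0 := by rwa [Real.cos_neg]
  have h0 : Real.cos 0 ≠ 0 := by simp
  set L := ‖1 - S ^ 2‖ * κ ^ 2 with hL
  have hpi : |Real.pi / 4| = Real.pi / 4 := abs_of_pos (by positivity)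
  have dp : ∀ n, ‖dyadicTanh S n (Real.pi / 4) * S ^ 2 - dyadicTanh S n 0 * S ^ 2‖ ≤
      L * (Real.pi / 4) * (1 / 2) ^ n := fun n => by
    refine (norm_dyadicTanh_sub_le hS hκ n hp h0).trans (le_of_eq ?_)
    rw [sub_zero, hpi]; ring
  have dm : ∀ n, ‖dyadicTanh S n (-(Real.pi / 4)) * S ^ 2 - dyadicTanh S n 0 * S ^ 2‖ ≤
      L * (Real.pi / 4) * (1 / 2) ^ n := fun n => by
    refine (norm_dyadicTanh_sub_le hS hκ n hm h0).trans (le_of_eq ?_)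
    rw [sub_zero, abs_neg, hpi]; ring
  -- Level n + 1 at angle 0 averages level n at ±π/4, so consecutive terms differ by a Lipschitz
  -- bound of order 2⁻ⁿ.
  have hcau : CauchySeq (fun n => dyadicTanh S n 0 * S ^ 2) := by
    refine cauchySeq_of_le_geometric (1 / 2) (L * (Real.pi / 4)) (by norm_num) fun n => ?_
    rw [dist_comm, dist_eq_norm]
    have e : dyadicTanh S (n + 1) 0 * S ^ 2 - dyadicTanh S n 0 * S ^ 2 = (1 / 2 : ℂ) •
        ((dyadicTanh S n (Real.pi / 4) * S ^ 2 - dyadicTanh S n 0 * S ^ 2) +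
        (dyadicTanh S n (-(Real.pi / 4)) * S ^ 2 - dyadicTanh S n 0 * S ^ 2)) := by
      simp only [dyadicTanh, smul_mul_assoc, add_mul, zero_div, zero_add, zero_sub]
      module
    rw [e, norm_smul]
    have e3 : ‖(1 / 2 : ℂ)‖ = 1 / 2 := by norm_num
    rw [e3]
    have := norm_add_le (dyadicTanh S n (Real.pi / 4) * S ^ 2 - dyadicTanh S n 0 * S ^ 2)
      (dyadicTanh S n (-(Real.pi / 4)) * S ^ 2 - dyadicTanh S n 0 * S ^ 2)
    linarith [dp n, dm n]
  obtain ⟨Γ, hΓ⟩ := cauchySeq_tendsto_of_complete hcau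
  have hgeo : Tendsto (fun n : ℕ => L * (Real.pi / 4) * (1 / 2 : ℝ) ^ n) atTop (𝓝 0) := by
    simpa using (tendsto_pow_atTop_nhds_zero_of_lt_one (r := (1 / 2 : ℝ)) (by norm_num)
      (by norm_num)).const_mul (L * (Real.pi / 4))
  have tp : Tendsto (fun n => dyadicTanh S n (Real.pi / 4) * S ^ 2) atTop (𝓝 Γ) := by
    simpa using (squeeze_zero_norm dp hgeo).add hΓ
  have tm : Tendsto (fun n => dyadicTanh S n (-(Real.pi / 4)) * S ^ 2) atTop (𝓝 Γ) := by
    simpa using (squeeze_zero_norm dm hgeo).add hΓ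
  refine ⟨Γ, hΓ, ?_, ?_⟩
  · refine tendsto_nhds_unique (hΓ.const_mul S) ((hΓ.mul_const S).congr fun n => ?_)
    exact (((commute_dyadicTanh (Commute.refl S) n 0).mul_right
      (Commute.refl S |>.pow_right 2)).eq).symm
  -- The values at π/4 and -π/4 have the same limit, while their product before regularization is
  -- exactly 1.
  · refine tendsto_nhds_unique (tp.mul tm) (tendsto_const_nhds.congr fun n => ?_)
    have hc := (commute_dyadicTanh ((Commute.refl S).pow_left 2) n (-(Real.pi / 4))).eq
    rw [mul_assoc, ← mul_assoc (S ^ 2), hc, mul_assoc, ← mul_assoc, dyadicTanh_mul_dyadicTanh hS,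
      one_mul, ← pow_add]

end Units

end DyadicCalculus

section Apply

variable {E : Type*} [NormedAddCommGroup E] [NormedSpace ℂ E]

theorem opMul_apply (S T : E →L[ℂ] E) (x : E) : (S * T) x = S (T x) := rfl

theorem opOne_apply (x : E) : (1 : E →L[ℂ] E) x = x := rfl

end Apply

/-! ### Part: orthogonal projections and the weighted indefinite forms. -/

section Indefinite

variable {E : Type*} [NormedAddCommGroup E] [InnerProductSpace ℂ E] [CompleteSpace E]

/-- The weighted difference `a P - b (1 - P)` of complementary projections. -/
def weighted (P : E →L[ℂ] E) (a b : ℝ) : E →L[ℂ] E := (a : ℂ) • P - (b : ℂ) • (1 - P)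

omit [CompleteSpace E] in
theorem weighted_apply (P : E →L[ℂ] E) (a b : ℝ) (x : E) :
    weighted P a b x = (a : ℂ) • P x - (b : ℂ) • (x - P x) := rfl

variable {P : E →L[ℂ] E} (hP : IsStarProjection P)

include hP

theorem proj_proj (x : E) : P (P x) = P x := DFunLike.congr_fun hP.isIdempotentElem x

theorem inner_proj_left (x y : E) : ⟪P x, y⟫_ℂ = ⟪x, P y⟫_ℂ :=
  hP.isSelfAdjoint.isSymmetric x y

theorem inner_proj_compl (x y : E) : ⟪P x, y - P y⟫_ℂ = 0 := by
  rw [inner_proj_left hP, map_sub, proj_proj hP, sub_self, inner_zero_right]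

theorem inner_compl_proj (x y : E) : ⟪x - P x, P y⟫_ℂ = 0 := by
  rw [← inner_proj_left hP, map_sub, proj_proj hP, sub_self, inner_zero_left]

theorem norm_sq_eq_proj (x : E) : ‖x‖ ^ 2 = ‖P x‖ ^ 2 + ‖x - P x‖ ^ 2 := by
  have h := norm_add_sq_eq_norm_sq_add_norm_sq_of_inner_eq_zero (P x) (x - P x)
    (inner_proj_compl hP x x)
  rw [add_sub_cancel] at h
  simp only [pow_two]
  exact h

theorem norm_proj_le (x : E) : ‖P x‖ ≤ ‖x‖ := by
  have := norm_sq_eq_proj hP x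
  exact abs_le_of_sq_le_sq' (by nlinarith [sq_nonneg ‖x - P x‖]) (norm_nonneg x) |>.2

theorem norm_sub_proj_le (x : E) : ‖x - P x‖ ≤ ‖x‖ := by
  have := norm_sq_eq_proj hP x
  exact abs_le_of_sq_le_sq' (by nlinarith [sq_nonneg ‖P x‖]) (norm_nonneg x) |>.2

omit [CompleteSpace E] hP in
theorem re_inner_weighted_left (a b : ℝ) (x y : E) :
    (⟪weighted P a b x, y⟫_ℂ).re =
      a * (⟪P x, y⟫_ℂ).re - b * (⟪x - P x, y⟫_ℂ).re := by
  rw [weighted_apply, inner_sub_left, inner_smul_left, inner_smul_left, Complex.sub_re,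
    Complex.conj_ofReal, Complex.conj_ofReal, Complex.re_ofReal_mul, Complex.re_ofReal_mul]

theorem inner_weighted_left (a b : ℝ) (x y : E) :
    ⟪weighted P a b x, y⟫_ℂ = ⟪x, weighted P a b y⟫_ℂ := by
  simp only [weighted_apply, inner_sub_left, inner_sub_right, inner_smul_left, inner_smul_right,
    inner_proj_left hP, Complex.conj_ofReal]

theorem re_inner_weighted_self (a b : ℝ) (x : E) :
    (⟪weighted P a b x, x⟫_ℂ).re = a * ‖P x‖ ^ 2 - b * ‖x - P x‖ ^ 2 := by
  have h1 : ⟪P x, x⟫_ℂ = ⟪P x, P x⟫_ℂ := by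
    rw [inner_proj_left hP (x) (P x), proj_proj hP, ← inner_proj_left hP]
  have h2 : ⟪x - P x, x⟫_ℂ = ⟪x - P x, x - P x⟫_ℂ := by
    rw [inner_sub_right, inner_compl_proj hP, sub_zero]
  rw [re_inner_weighted_left, h1, h2, inner_self_eq_norm_sq_to_K, inner_self_eq_norm_sq_to_K]
  norm_cast

theorem weighted_one_one_sq : weighted P 1 1 * weighted P 1 1 = 1 := by
  ext x
  simp only [opMul_apply, weighted_apply, map_sub, map_smul, proj_proj hP, opOne_apply]
  simp

theorem isUnit_weighted_one_one : IsUnit (weighted P 1 1) :=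
  ⟨⟨_, _, weighted_one_one_sq hP, weighted_one_one_sq hP⟩, rfl⟩

theorem norm_weighted_one_one_apply (x : E) : ‖weighted P 1 1 x‖ = ‖x‖ := by
  have h : ⟪weighted P 1 1 x, weighted P 1 1 x⟫_ℂ = ⟪x, x⟫_ℂ := by
    rw [inner_weighted_left hP, ← opMul_apply, weighted_one_one_sq hP, opOne_apply]
  rw [inner_self_eq_norm_sq_to_K, inner_self_eq_norm_sq_to_K] at h
  norm_cast at h
  exact (sq_eq_sq₀ (norm_nonneg _) (norm_nonneg _)).1 h

end Indefinite

/-! ### Part: Möbius transforms preserve accretivity for an indefinite form. -/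

section Cayley

variable {E : Type*} [NormedAddCommGroup E] [InnerProductSpace ℂ E]

/-- Put u = (cos α + i sin α S)w. Symmetry of K makes ⟨Kw, w⟩ and ⟨KSw, Sw⟩ real, so they enter only
the imaginary part, and what remains is (cos² α + sin² α) Re⟨Kw, Sw⟩. -/
theorem re_inner_cayley_nonneg {K S : E →L[ℂ] E} (hK : ∀ x y, ⟪K x, y⟫_ℂ = ⟪x, K y⟫_ℂ)
    (hKS : ∀ x, 0 ≤ (⟪K x, S x⟫_ℂ).re) {α : ℝ} (hα : IsUnit (cayleyDen S α)) (u : E) :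
    0 ≤ (⟪K u, cayley S α u⟫_ℂ).re := by
  obtain ⟨w, rfl⟩ : ∃ w, cayleyDen S α w = u :=
    ⟨Ring.inverse (cayleyDen S α) u, by
      rw [← opMul_apply, Ring.mul_inverse_cancel _ hα, opOne_apply]⟩
  have e : cayley S α (cayleyDen S α w) =
      (Real.cos α : ℂ) • S w + (Real.sin α * Complex.I) • w := by
    rw [cayley, ← opMul_apply, mul_assoc, Ring.inverse_mul_cancel _ hα, mul_one]
    rfl
  have e' : cayleyDen S α w = (Real.cos α : ℂ) • w + (Real.sin α * Complex.I) • S w := rfl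
  have himag : ∀ x, (⟪K x, x⟫_ℂ).im = 0 := fun x =>
    Complex.conj_eq_iff_im.1 (by rw [inner_conj_symm, hK])
  have hreal := himag w
  have hreal' := himag (S w)
  have hsym : (⟪K (S w), w⟫_ℂ).re = (⟪K w, S w⟫_ℂ).re := by
    rw [hK, ← inner_conj_symm, Complex.conj_re]
  rw [e, e', map_add, map_smul, map_smul]
  simp only [inner_add_left, inner_add_right, inner_smul_left, inner_smul_right, map_mul,
    Complex.conj_ofReal, Complex.conj_I, Complex.add_re, Complex.mul_re, Complex.mul_im,
    Complex.ofReal_re, Complex.ofReal_im, Complex.neg_re, Complex.neg_im, Complex.I_re,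
    Complex.I_im, Complex.add_im, hreal, hreal', hsym]
  have := hKS w
  have h1 : Real.cos α ^ 2 + Real.sin α ^ 2 = 1 := Real.cos_sq_add_sin_sq α
  ring_nf
  nlinarith

theorem re_inner_dyadicTanh_nonneg {K S : E →L[ℂ] E} (hK : ∀ x y, ⟪K x, y⟫_ℂ = ⟪x, K y⟫_ℂ)
    (hKS : ∀ x, 0 ≤ (⟪K x, S x⟫_ℂ).re)
    (hS : ∀ α : ℝ, Real.cos α ≠ 0 → IsUnit (cayleyDen S α)) (n : ℕ) :
    ∀ α : ℝ, Real.cos α ≠ 0 → ∀ u : E, 0 ≤ (⟪K u, dyadicTanh S n α u⟫_ℂ).re := by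
  induction n with
  | zero => exact fun α hα u => re_inner_cayley_nonneg hK hKS (hS α hα) u
  | succ n ih =>
    intro α hα u
    have h1 := ih _ (cos_half_add_ne_zero hα).1 u
    have h2 := ih _ (cos_half_add_ne_zero hα).2 u
    have e : dyadicTanh S (n + 1) α u = (1 / 2 : ℂ) •
        (dyadicTanh S n (α / 2 + Real.pi / 4) u + dyadicTanh S n (α / 2 - Real.pi / 4) u) := rfl
    have e2 : (1 / 2 : ℂ) = ((1 / 2 : ℝ) : ℂ) := by norm_num
    rw [e, e2, inner_smul_right, inner_add_right, Complex.re_ofReal_mul, Complex.add_re]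
    linarith

end Cayley

/-! ### Part: separated cones and boundedness of the sign. -/

section Cones

variable {E : Type*} [NormedAddCommGroup E] [InnerProductSpace ℂ E]

/-- Two vectors in the opposite cones given by `P` and `s < 1` do not cancel. -/
theorem norm_add_norm_le_of_cones {P : E →L[ℂ] E} (hle : ∀ x, ‖P x‖ ≤ ‖x‖)
    (hle' : ∀ x, ‖x - P x‖ ≤ ‖x‖) {s : ℝ} (hs0 : 0 ≤ s) (hs1 : s < 1) {x y : E}
    (hx : ‖x - P x‖ ≤ s * ‖P x‖) (hy : ‖P y‖ ≤ s * ‖y - P y‖) :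
    ‖x‖ + ‖y‖ ≤ 2 * (1 + s) / (1 - s) * ‖x + y‖ := by
  have h1 : ‖P x‖ - ‖P y‖ ≤ ‖x + y‖ := by
    refine le_trans ?_ (hle (x + y))
    have := norm_sub_norm_le (P x) (-P y)
    rw [norm_neg, sub_neg_eq_add, ← map_add] at this
    exact this
  have h2 : ‖y - P y‖ - ‖x - P x‖ ≤ ‖x + y‖ := by
    refine le_trans ?_ (hle' (x + y))
    have := norm_sub_norm_le (y - P y) (-(x - P x))
    rw [norm_neg, sub_neg_eq_add] at this
    rwa [show x + y - P (x + y) = y - P y + (x - P x) by rw [map_add]; abel]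
  have h3 : ‖x‖ ≤ ‖P x‖ + ‖x - P x‖ := by simpa using norm_add_le (P x) (x - P x)
  have h4 : ‖y‖ ≤ ‖P y‖ + ‖y - P y‖ := by simpa using norm_add_le (P y) (y - P y)
  have hs : 0 < 1 - s := by linarith
  rw [div_mul_eq_mul_div, le_div_iff₀ hs]
  have h5 : ‖x‖ + ‖y‖ ≤ (1 + s) * (‖P x‖ + ‖y - P y‖) := by linarith
  have h6 : (1 - s) * (‖P x‖ + ‖y - P y‖) ≤ 2 * ‖x + y‖ := by linarith
  nlinarith

end Cones

section Dichotomy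

variable {E : Type*} [NormedAddCommGroup E] [InnerProductSpace ℂ E] [CompleteSpace E]

omit [CompleteSpace E] in
theorem denseRange_pow {S : E →L[ℂ] E} (hd : DenseRange S) (n : ℕ) : DenseRange (S ^ n) := by
  induction n with
  | zero => exact fun x => subset_closure ⟨x, rfl⟩
  | succ n ih =>
    rw [pow_succ']
    exact hd.comp ih S.continuous

/-- A bounded operator `S` with dense range and spectrum off the imaginary axis (except for `0`),
which is accretive with respect to indefinite scalar products, has a bounded sign. -/
theorem exists_bounded_sign {P S : E →L[ℂ] E} (hP : IsStarProjection P)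
    (hd : DenseRange S)
    (hS : ∀ α : ℝ, Real.cos α ≠ 0 → IsUnit (cayleyDen S α))
    {κ : ℝ} (hκ : ∀ α : ℝ, Real.cos α ≠ 0 → ‖S * Ring.inverse (cayleyDen S α)‖ ≤ κ)
    {s : ℝ} (hs0 : 0 ≤ s) (hs1 : s < 1)
    (hp : ∀ x, 0 ≤ (⟪weighted P (s ^ 2) 1 x, S x⟫_ℂ).re)
    (hm : ∀ x, 0 ≤ (⟪weighted P 1 (s ^ 2) x, S x⟫_ℂ).re) :
    ∃ G : E →L[ℂ] E, G * G = 1 ∧ Commute S G ∧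
      (∀ x, ‖(x + G x) - P (x + G x)‖ ≤ s * ‖P (x + G x)‖) ∧
      ∀ x, ‖P (x - G x)‖ ≤ s * ‖(x - G x) - P (x - G x)‖ := by
  obtain ⟨Γ, hΓ, hc, hsq⟩ := exists_tendsto_dyadicTanh hS hκ
  have hc2 : Commute (S ^ 2) Γ := hc.pow_left 2
  have hacc : ∀ a b : ℝ, (∀ x, 0 ≤ (⟪weighted P a b x, S x⟫_ℂ).re) →
      ∀ y, 0 ≤ (⟪weighted P a b ((S ^ 2) y), Γ y⟫_ℂ).re := by
    intro a b hab y
    have hev : Filter.Tendsto (fun n => (dyadicTanh S n 0 * S ^ 2) y) Filter.atTop (nhds (Γ y)) :=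
      ((ContinuousLinearMap.apply ℂ E y).continuous.tendsto Γ).comp hΓ
    have h2 : Filter.Tendsto
        (fun n => (⟪weighted P a b ((S ^ 2) y), (dyadicTanh S n 0 * S ^ 2) y⟫_ℂ).re)
        Filter.atTop (nhds (⟪weighted P a b ((S ^ 2) y), Γ y⟫_ℂ).re) :=
      (Complex.continuous_re.tendsto _).comp (tendsto_const_nhds.inner hev)
    refine ge_of_tendsto' h2 fun n => ?_
    exact re_inner_dyadicTanh_nonneg (inner_weighted_left hP a b) hab hS n 0 (by simp) _
  -- Γ acts on Γy + S²y as S², because Γ² = S⁴. Accretivity at this vector is thus Re⟨Kz, z⟩ ≥ 0 for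
  -- z = S²(Γy + S²y), which is the squared cone inequality.
  have conep : ∀ y, ‖(S ^ 2) (Γ y + (S ^ 2) y) - P ((S ^ 2) (Γ y + (S ^ 2) y))‖ ≤
      s * ‖P ((S ^ 2) (Γ y + (S ^ 2) y))‖ := by
    intro y
    have h := hacc _ _ hp (Γ y + (S ^ 2) y)
    have e : Γ (Γ y + (S ^ 2) y) = (S ^ 2) (Γ y + (S ^ 2) y) := by
      rw [map_add, map_add, ← opMul_apply Γ, ← opMul_apply Γ, ← opMul_apply (S ^ 2), ← opMul_apply (S ^ 2),
        hsq, ← hc2.eq, ← pow_add, add_comm]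
    rw [e, re_inner_weighted_self hP] at h
    refine abs_le_of_sq_le_sq' ?_ (by positivity) |>.2
    rw [mul_pow]
    linarith
  have conem : ∀ y, ‖P ((S ^ 2) ((S ^ 2) y - Γ y))‖ ≤
      s * ‖(S ^ 2) ((S ^ 2) y - Γ y) - P ((S ^ 2) ((S ^ 2) y - Γ y))‖ := by
    intro y
    have h := hacc _ _ hm ((S ^ 2) y - Γ y)
    have e : Γ ((S ^ 2) y - Γ y) = -(S ^ 2) ((S ^ 2) y - Γ y) := by
      rw [map_sub, map_sub, ← opMul_apply Γ, ← opMul_apply Γ, ← opMul_apply (S ^ 2), ← opMul_apply (S ^ 2),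
        hsq, ← hc2.eq, ← pow_add, neg_sub]
    rw [e, inner_neg_right, Complex.neg_re, re_inner_weighted_self hP] at h
    refine abs_le_of_sq_le_sq' ?_ (by positivity) |>.2
    rw [mul_pow]
    linarith
  have hsum : ∀ y, (S ^ 2) (Γ y + (S ^ 2) y) + (S ^ 2) ((S ^ 2) y - Γ y) =
      (2 : ℂ) • (S ^ 4) y := by
    intro y
    rw [← map_add, show Γ y + (S ^ 2) y + ((S ^ 2) y - Γ y) = (2 : ℂ) • (S ^ 2) y by
      rw [two_smul]; abel, map_smul, ← opMul_apply, ← pow_add]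
  -- 2S⁴y and 2S²Γy are the sum and the difference of one vector from each cone, and separated cones
  -- bound the difference by the sum.
  have hbound : ∀ y, ‖(S ^ 2 * Γ) y‖ ≤ 2 * (1 + s) / (1 - s) * ‖(S ^ 4) y‖ := by
    intro y
    have h := norm_add_norm_le_of_cones (norm_proj_le hP) (norm_sub_proj_le hP) hs0 hs1
      (conep y) (conem y)
    rw [hsum, norm_smul, Complex.norm_ofNat] at h
    have e : (2 : ℂ) • (S ^ 2 * Γ) y =
        (S ^ 2) (Γ y + (S ^ 2) y) - (S ^ 2) ((S ^ 2) y - Γ y) := by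
      rw [← map_sub, show Γ y + (S ^ 2) y - ((S ^ 2) y - Γ y) = (2 : ℂ) • Γ y by
        rw [two_smul]; abel, map_smul, opMul_apply]
    have h2 := norm_sub_le ((S ^ 2) (Γ y + (S ^ 2) y)) ((S ^ 2) ((S ^ 2) y - Γ y))
    rw [← e, norm_smul, Complex.norm_ofNat] at h2
    linarith
  have hd4 : DenseRange (S ^ 4 : E →L[ℂ] E) := denseRange_pow hd 4
  set G : E →L[ℂ] E := ((S ^ 2 * Γ : E →L[ℂ] E) : E →ₗ[ℂ] E).extendOfNorm
    ((S ^ 4 : E →L[ℂ] E) : E →ₗ[ℂ] E) with hG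
  have hGS : ∀ y, G ((S ^ 4) y) = (S ^ 2 * Γ) y := fun y =>
    LinearMap.extendOfNorm_eq (f := ((S ^ 2 * Γ : E →L[ℂ] E) : E →ₗ[ℂ] E)) hd4 ⟨_, hbound⟩ y
  have hGS' : G * S ^ 4 = S ^ 2 * Γ := ContinuousLinearMap.ext hGS
  -- S may lack a bounded inverse, but its powers have dense range; identities for G are checked
  -- after multiplying by a power of S on the right.
  have hcancel : ∀ n, ∀ X Y : E →L[ℂ] E, X * S ^ n = Y * S ^ n → X = Y := by
    intro n X Y h
    have := (denseRange_pow hd n).equalizer X.continuous Y.continuous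
      (funext fun y => DFunLike.congr_fun h y)
    exact DFunLike.coe_injective this
  have hcom : Commute S G := by
    refine hcancel 4 _ _ ?_
    have h1 : S * G * S ^ 4 = S ^ 3 * Γ := by
      rw [mul_assoc, hGS', ← mul_assoc, ← pow_succ']
    rw [h1, mul_assoc, ← pow_succ', pow_succ S 4, ← mul_assoc, hGS', mul_assoc, ← hc.eq,
      ← mul_assoc, ← pow_succ]
  refine ⟨G, ?_, hcom, ?_, ?_⟩
  · refine hcancel 8 _ _ ?_
    have e1 : G * S ^ 8 = S ^ 6 * Γ := by
      rw [show 8 = 4 + 4 by norm_num, pow_add, ← mul_assoc, hGS', mul_assoc,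
        ← (hc.pow_left 4).eq, ← mul_assoc, ← pow_add]
    have e2 : G * S ^ 6 = S ^ 4 * Γ := by
      rw [show 6 = 4 + 2 by norm_num, pow_add, ← mul_assoc, hGS', mul_assoc, ← hc2.eq,
        ← mul_assoc, ← pow_add]
    rw [mul_assoc, e1, ← mul_assoc, e2, mul_assoc, hsq, one_mul, ← pow_add]
  · refine fun x => isClosed_property hd4 (p := fun x => ‖(x + G x) - P (x + G x)‖ ≤
      s * ‖P (x + G x)‖) (isClosed_le (by fun_prop) (by fun_prop)) (fun y => ?_) x
    have e : (S ^ 4) y + G ((S ^ 4) y) = (S ^ 2) (Γ y + (S ^ 2) y) := by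
      rw [hGS, map_add, opMul_apply, ← opMul_apply (S ^ 2) (S ^ 2), ← pow_add, add_comm]
    rw [e]
    exact conep y
  · refine fun x => isClosed_property hd4 (p := fun x => ‖P (x - G x)‖ ≤
      s * ‖(x - G x) - P (x - G x)‖) (isClosed_le (by fun_prop) (by fun_prop)) (fun y => ?_) x
    have e : (S ^ 4) y - G ((S ^ 4) y) = (S ^ 2) ((S ^ 2) y - Γ y) := by
      rw [hGS, map_sub, opMul_apply, ← opMul_apply (S ^ 2) (S ^ 2), ← pow_add]
    rw [e]
    exact conem y

end Dichotomy

/-! ### Part: coercivity of the perturbed form and estimates for S = A B⁻¹ A. -/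

section Perturbation

variable {E : Type*} [NormedAddCommGroup E] [InnerProductSpace ℂ E] [CompleteSpace E]

/-- `A` plays the role of `|H₀|^{-1/2}`, `P` that of the positive spectral projection, and `V` that
of the bounded operator given by the perturbing form, whose blocks with respect to `P` are bounded
by `ρ`. -/
structure IsBlockSmall (A P V : E →L[ℂ] E) (ρ : ℝ) : Prop where
  sa : IsSelfAdjoint A
  inj : Function.Injective A
  proj : IsStarProjection P
  comm : Commute A P
  bound : ∀ x y, (P x = x ∨ P x = 0) → (P y = y ∨ P y = 0) → ‖⟪x, V y⟫_ℂ‖ ≤ ρ * ‖x‖ * ‖y‖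
  nonneg : 0 ≤ ρ
  lt_half : ρ < 1 / 2

/-- The bounded operator representing the perturbed form. -/
def formOp (P V : E →L[ℂ] E) : E →L[ℂ] E := weighted P 1 1 + V

/-- The inverse of the operator associated with the perturbed form. -/
def assocInv (A P V : E →L[ℂ] E) : E →L[ℂ] E := A * Ring.inverse (formOp P V) * A

/-- Lax–Milgram applied to JT. No definiteness of J is needed, only symmetry and invertibility. -/
theorem isUnit_of_re_coercive {J T : E →L[ℂ] E} (hJ : IsUnit J)
    (hJs : ∀ x y, ⟪J x, y⟫_ℂ = ⟪x, J y⟫_ℂ) {c : ℝ} (hc : 0 < c)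
    (h : ∀ x, c * ‖x‖ ^ 2 ≤ |(⟪J x, T x⟫_ℂ).re|) : IsUnit T := by
  have hu : IsUnit (J * T) := by
    refine ContinuousLinearMap.isUnit_of_forall_le_norm_inner_map _ (c := ⟨c, hc.le⟩) hc fun x => ?_
    rw [norm_inner_symm, opMul_apply, ← hJs]
    refine le_trans ?_ (Complex.abs_re_le_norm _)
    rw [mul_comm]
    exact h x
  have := hJ.ringInverse.mul hu
  rwa [Ring.inverse_mul_cancel_left _ _ hJ] at this

-- A Woodbury formula: with m = cB + dA², the inverse is c⁻¹(1 - d A m⁻¹ A). It moves invertibility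
-- to m, where coercivity is available.
omit [CompleteSpace E] in
theorem isUnit_add_smul_mul_mul {A B : E →L[ℂ] E} (hB : IsUnit B) {c d : ℂ} (hc : c ≠ 0)
    (hu : IsUnit (c • B + d • (A * A))) :
    IsUnit (c • (1 : E →L[ℂ] E) + d • (A * Ring.inverse B * A)) := by
  obtain ⟨b, rfl⟩ := hB
  obtain ⟨m, hm⟩ := hu
  rw [Ring.inverse_unit]
  have h1 : d • (A * A * (↑m⁻¹ : E →L[ℂ] E)) = 1 - c • ((b : E →L[ℂ] E) * ↑m⁻¹) := by
    have : (c • (b : E →L[ℂ] E) + d • (A * A)) * ↑m⁻¹ = 1 := by rw [← hm]; simp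
    rw [add_mul, smul_mul_assoc, smul_mul_assoc] at this
    exact eq_sub_of_add_eq' this
  have h2 : d • ((↑m⁻¹ : E →L[ℂ] E) * (A * A)) = 1 - c • (↑m⁻¹ * (b : E →L[ℂ] E)) := by
    have : ↑m⁻¹ * (c • (b : E →L[ℂ] E) + d • (A * A)) = 1 := by rw [← hm]; simp
    rw [mul_add, mul_smul_comm, mul_smul_comm] at this
    exact eq_sub_of_add_eq' this
  refine ⟨⟨_, c⁻¹ • (1 - d • (A * ↑m⁻¹ * A)), ?_, ?_⟩, rfl⟩
  · have h3 : d • (A * (↑b⁻¹ : E →L[ℂ] E) * A * (A * ↑m⁻¹ * A)) =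
        A * ↑b⁻¹ * A - c • (A * ↑m⁻¹ * A) := by
      have : d • (A * (↑b⁻¹ : E →L[ℂ] E) * A * (A * ↑m⁻¹ * A)) =
          A * ↑b⁻¹ * (d • (A * A * ↑m⁻¹)) * A := by
        simp only [mul_smul_comm, smul_mul_assoc, mul_assoc]
      rw [this, h1]
      simp only [mul_sub, sub_mul, mul_one, mul_smul_comm, smul_mul_assoc, mul_assoc,
        Units.inv_mul_cancel_left]
    rw [mul_smul_comm, add_mul, mul_sub, mul_sub, smul_mul_smul_comm, smul_mul_smul_comm, mul_one,
      mul_one, one_mul, mul_smul d d, h3]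
    rw [smul_sub, smul_smul, mul_comm d c]
    rw [smul_add, smul_sub, smul_sub, smul_sub, smul_smul, inv_mul_cancel₀ hc]
    module
  · have h3 : d • (A * (↑m⁻¹ : E →L[ℂ] E) * A * (A * ↑b⁻¹ * A)) =
        A * ↑b⁻¹ * A - c • (A * ↑m⁻¹ * A) := by
      have : d • (A * (↑m⁻¹ : E →L[ℂ] E) * A * (A * ↑b⁻¹ * A)) =
          A * (d • (↑m⁻¹ * (A * A))) * ↑b⁻¹ * A := by
        simp only [mul_smul_comm, smul_mul_assoc, mul_assoc]
      rw [this, h2]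
      simp only [mul_sub, sub_mul, mul_one, mul_smul_comm, smul_mul_assoc, mul_assoc,
        Units.mul_inv_cancel_left]
    rw [smul_mul_assoc, mul_add, sub_mul, sub_mul, smul_mul_smul_comm, smul_mul_smul_comm, mul_one,
      one_mul, one_mul, mul_smul d d, h3]
    rw [smul_sub, smul_smul, mul_comm d c]
    rw [smul_add, smul_sub, smul_sub, smul_sub, smul_smul, inv_mul_cancel₀ hc]
    module

variable {A P V : E →L[ℂ] E} {ρ : ℝ} (h : IsBlockSmall A P V ρ)

include h

/-- Expand along y = Py + (y - Py). The diagonal blocks of V cost at most ρ times the squares; the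
two off-diagonal ones cost aρ and bρ times the mixed product. -/
theorem IsBlockSmall.le_re_inner {a b : ℝ} (ha : 0 ≤ a) (hb : 0 ≤ b) (y : E) :
    (1 - ρ) * (a * ‖P y‖ ^ 2 + b * ‖y - P y‖ ^ 2) - (a + b) * ρ * (‖P y‖ * ‖y - P y‖) ≤
      (⟪weighted P a b y, formOp P V y⟫_ℂ).re := by
  have hp1 : P (P y) = P y := proj_proj h.proj y
  have hn1 : P (y - P y) = 0 := by rw [map_sub, hp1, sub_self]
  have b1 := (Complex.abs_re_le_norm _).trans (h.bound (P y) (P y) (Or.inl hp1) (Or.inl hp1))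
  have b2 := (Complex.abs_re_le_norm _).trans
    (h.bound (P y) (y - P y) (Or.inl hp1) (Or.inr hn1))
  have b3 := (Complex.abs_re_le_norm _).trans
    (h.bound (y - P y) (P y) (Or.inr hn1) (Or.inl hp1))
  have b4 := (Complex.abs_re_le_norm _).trans
    (h.bound (y - P y) (y - P y) (Or.inr hn1) (Or.inr hn1))
  have e : formOp P V y = (P y - (y - P y)) + (V (P y) + V (y - P y)) := by
    rw [← map_add, add_sub_cancel]
    change weighted P 1 1 y + V y = _
    rw [weighted_apply]
    simp
  have e1 : ⟪P y, y - P y⟫_ℂ = 0 := inner_proj_compl h.proj y y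
  have e2 : ⟪y - P y, P y⟫_ℂ = 0 := inner_compl_proj h.proj y y
  have e3 : (⟪P y, P y⟫_ℂ).re = ‖P y‖ ^ 2 := by
    rw [inner_self_eq_norm_sq_to_K]; norm_cast
  have e4 : (⟪y - P y, y - P y⟫_ℂ).re = ‖y - P y‖ ^ 2 := by
    rw [inner_self_eq_norm_sq_to_K]; norm_cast
  have key : (⟪weighted P a b y, formOp P V y⟫_ℂ).re =
      a * (‖P y‖ ^ 2 + (⟪P y, V (P y)⟫_ℂ).re + (⟪P y, V (y - P y)⟫_ℂ).re) +
      b * (‖y - P y‖ ^ 2 - (⟪y - P y, V (P y)⟫_ℂ).re - (⟪y - P y, V (y - P y)⟫_ℂ).re) := by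
    rw [re_inner_weighted_left, e]
    generalize y - P y = z at *
    rw [inner_add_right, inner_add_right, inner_add_right,
      inner_add_right, inner_sub_right, inner_sub_right, e1, e2]
    simp only [Complex.add_re, Complex.sub_re, e3, e4, Complex.zero_re]
    ring
  rw [key]
  have c1 := mul_le_mul_of_nonneg_left (neg_le_of_abs_le b1) ha
  have c2 := mul_le_mul_of_nonneg_left (neg_le_of_abs_le b2) ha
  have c3 := mul_le_mul_of_nonneg_left (le_of_abs_le b3) hb
  have c4 := mul_le_mul_of_nonneg_left (le_of_abs_le b4) hb
  nlinarith

theorem IsBlockSmall.le_re_inner_one_one (y : E) :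
    (1 - 2 * ρ) * ‖y‖ ^ 2 ≤ (⟪weighted P 1 1 y, formOp P V y⟫_ℂ).re := by
  refine le_trans ?_ (h.le_re_inner zero_le_one zero_le_one y)
  rw [norm_sq_eq_proj h.proj y]
  nlinarith [mul_nonneg h.nonneg (sq_nonneg (‖P y‖ - ‖y - P y‖))]

/-- The condition on s makes the lower bound of `le_re_inner` at least (1 - ρ) times a square, such
as (s‖Py‖ - ‖y - Py‖)². -/
theorem IsBlockSmall.re_inner_nonneg {s : ℝ} (hs : (1 + s ^ 2) * ρ ≤ 2 * (1 - ρ) * s) (y : E) :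
    0 ≤ (⟪weighted P (s ^ 2) 1 y, formOp P V y⟫_ℂ).re ∧
      0 ≤ (⟪weighted P 1 (s ^ 2) y, formOp P V y⟫_ℂ).re := by
  have hρ := h.lt_half
  have hpn : 0 ≤ ‖P y‖ * ‖y - P y‖ := by positivity
  have h1 := mul_le_mul_of_nonneg_right hs hpn
  constructor
  · refine le_trans ?_ (h.le_re_inner (sq_nonneg s) zero_le_one y)
    nlinarith [mul_nonneg (by linarith : 0 ≤ 1 - ρ) (sq_nonneg (s * ‖P y‖ - ‖y - P y‖))]
  · refine le_trans ?_ (h.le_re_inner zero_le_one (sq_nonneg s) y)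
    nlinarith [mul_nonneg (by linarith : 0 ≤ 1 - ρ) (sq_nonneg (‖P y‖ - s * ‖y - P y‖))]

theorem IsBlockSmall.isUnit_formOp : IsUnit (formOp P V) := by
  have hρ := h.lt_half
  refine isUnit_of_re_coercive (J := weighted P 1 1) (isUnit_weighted_one_one h.proj)
    (inner_weighted_left h.proj 1 1) (c := 1 - 2 * ρ) (by linarith) fun x => ?_
  exact (h.le_re_inner_one_one x).trans (le_abs_self _)

theorem IsBlockSmall.inner_left (x y : E) : ⟪A x, y⟫_ℂ = ⟪x, A y⟫_ℂ := h.sa.isSymmetric x y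

theorem IsBlockSmall.weighted_apply_comm (a b : ℝ) (x : E) :
    weighted P a b (A x) = A (weighted P a b x) := by
  have : A (P x) = P (A x) := DFunLike.congr_fun h.comm.eq x
  simp only [weighted_apply, map_sub, map_smul, this]

theorem IsBlockSmall.denseRange : DenseRange A := by
  have h1 : A.rangeᗮ = ⊥ := by
    rw [ContinuousLinearMap.orthogonal_range, h.sa.adjoint_eq]
    exact LinearMap.ker_eq_bot.2 h.inj
  rw [← Submodule.topologicalClosure_eq_top_iff] at h1
  intro x
  have : x ∈ A.range.topologicalClosure := by rw [h1]; trivial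
  exact this

theorem IsBlockSmall.inverse_formOp_apply (x : E) :
    formOp P V (Ring.inverse (formOp P V) x) = x := by
  rw [← opMul_apply, Ring.mul_inverse_cancel _ h.isUnit_formOp, opOne_apply]

theorem IsBlockSmall.inverse_apply_formOp (x : E) :
    Ring.inverse (formOp P V) (formOp P V x) = x := by
  rw [← opMul_apply, Ring.inverse_mul_cancel _ h.isUnit_formOp, opOne_apply]

theorem IsBlockSmall.denseRange_inverse : DenseRange (Ring.inverse (formOp P V) : E →L[ℂ] E) := fun x =>
  subset_closure ⟨formOp P V x, h.inverse_apply_formOp x⟩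

theorem IsBlockSmall.denseRange_assocInv : DenseRange (assocInv A P V) :=
  (h.denseRange.comp h.denseRange_inverse A.continuous).comp h.denseRange
    (A * Ring.inverse (formOp P V)).continuous

theorem IsBlockSmall.injective_assocInv : Function.Injective (assocInv A P V) :=
  (h.inj.comp (Function.LeftInverse.injective h.inverse_formOp_apply)).comp h.inj

/-- The weights commute with A, so accretivity passes from B to S through y = B⁻¹Ax. -/
theorem IsBlockSmall.re_inner_weighted_assocInv (a b : ℝ) (x : E) :
    (⟪weighted P a b x, assocInv A P V x⟫_ℂ).re =
      (⟪weighted P a b (Ring.inverse (formOp P V) (A x)),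
        formOp P V (Ring.inverse (formOp P V) (A x))⟫_ℂ).re := by
  rw [h.inverse_formOp_apply, ← h.inner_left, ← h.weighted_apply_comm, inner_weighted_left h.proj,
    ← inner_conj_symm, Complex.conj_re]
  rfl

/-- JA² is symmetric, so its quadratic form is real and the coefficient ir removes it from the real
part. -/
theorem IsBlockSmall.abs_re_inner_pencil (c r : ℝ) (y : E) :
    |c| * ((1 - 2 * ρ) * ‖y‖ ^ 2) ≤
      |(⟪weighted P 1 1 y, (c : ℂ) • formOp P V y + (r * Complex.I) • A (A y)⟫_ℂ).re| := by
  have him : (⟪weighted P 1 1 y, A (A y)⟫_ℂ).im = 0 := by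
    rw [← h.inner_left, ← h.weighted_apply_comm]
    exact Complex.conj_eq_iff_im.1 (by rw [inner_conj_symm, inner_weighted_left h.proj])
  have e : (⟪weighted P 1 1 y, (c : ℂ) • formOp P V y + (r * Complex.I) • A (A y)⟫_ℂ).re =
      c * (⟪weighted P 1 1 y, formOp P V y⟫_ℂ).re := by
    rw [inner_add_right, inner_smul_right, inner_smul_right]
    simp [him]
  rw [e, abs_mul]
  exact mul_le_mul_of_nonneg_left ((h.le_re_inner_one_one y).trans (le_abs_self _)) (abs_nonneg c)

theorem IsBlockSmall.isUnit_pencil {c : ℝ} (hc : c ≠ 0) (r : ℝ) :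
    IsUnit ((c : ℂ) • formOp P V + (r * Complex.I) • (A * A)) := by
  have hρ := h.lt_half
  refine isUnit_of_re_coercive (J := weighted P 1 1) (isUnit_weighted_one_one h.proj)
    (inner_weighted_left h.proj 1 1) (c := |c| * (1 - 2 * ρ))
    (mul_pos (abs_pos.2 hc) (by linarith)) fun x => ?_
  rw [mul_assoc]
  exact h.abs_re_inner_pencil c r x

theorem IsBlockSmall.isUnit_cayleyDen (α : ℝ) (hα : Real.cos α ≠ 0) :
    IsUnit (cayleyDen (assocInv A P V) α) :=
  isUnit_add_smul_mul_mul h.isUnit_formOp (by exact_mod_cast hα) (h.isUnit_pencil hα _)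

theorem IsBlockSmall.norm_mul_inverse_cayleyDen_le (α : ℝ) (hα : Real.cos α ≠ 0) :
    ‖assocInv A P V * Ring.inverse (cayleyDen (assocInv A P V) α)‖ ≤
      (‖formOp P V‖ + ‖A‖ ^ 2) / (1 - 2 * ρ) + 1 := by
  set S := assocInv A P V with hS
  have hρ := h.lt_half
  have hm : 0 < 1 - 2 * ρ := by linarith
  refine ContinuousLinearMap.opNorm_le_bound _ (by positivity) fun x => ?_
  set u := Ring.inverse (cayleyDen S α) x with hu
  set w := Ring.inverse (formOp P V) (A u) with hw
  set c := Real.cos α with hc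
  set r := Real.sin α with hr
  have h1 : (c : ℂ) • u + (r * Complex.I) • A w = x := by
    have : cayleyDen S α u = x := by
      rw [hu, ← opMul_apply, Ring.mul_inverse_cancel _ (h.isUnit_cayleyDen α hα), opOne_apply]
    exact this
  have h2 : formOp P V w = A u := h.inverse_formOp_apply _
  have h3 : (c : ℂ) • formOp P V w + (r * Complex.I) • A (A w) = A x := by
    rw [h2, ← h1, map_add, map_smul, map_smul]
  change ‖A w‖ ≤ _
  set q := ‖A w‖ with hq
  -- Testing the equation `h3` with Jw controls |cos α|‖w‖², and testing it with w controls |sin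
  -- α|‖Aw‖² (`k2`). Since |cos α| + |sin α| ≥ 1, the two together bound ‖Aw‖ uniformly in α.
  have k1 : |c| * ((1 - 2 * ρ) * ‖w‖ ^ 2) ≤ q * ‖x‖ := by
    refine (h.abs_re_inner_pencil c r w).trans ?_
    rw [h3, ← h.inner_left, ← h.weighted_apply_comm]
    refine (Complex.abs_re_le_norm _).trans ((norm_inner_le_norm _ _).trans ?_)
    rw [norm_weighted_one_one_apply h.proj]
  have k2 : |r| * q ^ 2 ≤ |c| * (‖formOp P V‖ * ‖w‖ ^ 2) + q * ‖x‖ := by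
    have e : ((r : ℂ) * Complex.I) * ⟪A w, A w⟫_ℂ =
        ⟪A w, x⟫_ℂ - (c : ℂ) * ⟪w, formOp P V w⟫_ℂ := by
      rw [h.inner_left w x, ← h3, inner_add_right, inner_smul_right, inner_smul_right,
        h.inner_left w (A w)]
      ring
    have e2 := congrArg norm e
    rw [inner_self_eq_norm_sq_to_K, norm_mul, norm_mul, Complex.norm_I, mul_one, norm_pow] at e2
    simp only [Complex.norm_real, Real.norm_eq_abs, Complex.coe_algebraMap, abs_norm] at e2
    rw [hq, e2]
    refine (norm_sub_le _ _).trans ?_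
    rw [add_comm, norm_mul, Complex.norm_real, Real.norm_eq_abs]
    refine add_le_add (mul_le_mul_of_nonneg_left ?_ (abs_nonneg c)) (norm_inner_le_norm _ _)
    refine (norm_inner_le_norm _ _).trans ?_
    have := (formOp P V).le_opNorm w
    nlinarith [norm_nonneg w]
  have k3 : q ^ 2 ≤ ‖A‖ ^ 2 * ‖w‖ ^ 2 := by
    rw [← mul_pow]
    exact pow_le_pow_left₀ (norm_nonneg _) (A.le_opNorm w) 2
  have k4 : 1 ≤ |c| + |r| := by
    have h5 : |c| ^ 2 + |r| ^ 2 = 1 := by rw [sq_abs, sq_abs]; exact Real.cos_sq_add_sin_sq α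
    nlinarith [abs_nonneg c, abs_nonneg r]
  have hwq : |c| * ‖w‖ ^ 2 ≤ q * ‖x‖ / (1 - 2 * ρ) := by
    rw [le_div_iff₀ hm]; linarith
  have k5 : q ^ 2 ≤ (((‖formOp P V‖ + ‖A‖ ^ 2) / (1 - 2 * ρ) + 1) * ‖x‖) * q := by
    have i1 := mul_le_mul_of_nonneg_right k4 (sq_nonneg q)
    have i2 := mul_le_mul_of_nonneg_left k3 (abs_nonneg c)
    have i3 := mul_le_mul_of_nonneg_left hwq (by positivity : 0 ≤ ‖formOp P V‖ + ‖A‖ ^ 2)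
    have i4 : (‖formOp P V‖ + ‖A‖ ^ 2) * (q * ‖x‖ / (1 - 2 * ρ)) =
      ((‖formOp P V‖ + ‖A‖ ^ 2) / (1 - 2 * ρ)) * (‖x‖ * q) := by ring
    nlinarith
  rcases (norm_nonneg (A w)).eq_or_lt with hq0 | hq0
  · rw [hq, ← hq0]; positivity
  · rw [pow_two] at k5
    exact le_of_mul_le_mul_right k5 hq0

/-- The bounded sign of the perturbed operator. -/
theorem IsBlockSmall.exists_sign {s : ℝ} (hs0 : 0 ≤ s) (hs1 : s < 1)
    (hs : (1 + s ^ 2) * ρ ≤ 2 * (1 - ρ) * s) :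
    ∃ G : E →L[ℂ] E, G * G = 1 ∧ Commute (assocInv A P V) G ∧
      (∀ x, ‖(x + G x) - P (x + G x)‖ ≤ s * ‖P (x + G x)‖) ∧
      ∀ x, ‖P (x - G x)‖ ≤ s * ‖(x - G x) - P (x - G x)‖ := by
  refine exists_bounded_sign h.proj h.denseRange_assocInv h.isUnit_cayleyDen
    h.norm_mul_inverse_cayleyDen_le hs0 hs1 (fun x => ?_) fun x => ?_
  · rw [h.re_inner_weighted_assocInv]
    exact (h.re_inner_nonneg hs _).1
  · rw [h.re_inner_weighted_assocInv]
    exact (h.re_inner_nonneg hs _).2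

end Perturbation

/-! ### Part: spectral subspaces of the sign as graphs over perturbed projections. -/

section SignProj

variable {E : Type*} [NormedAddCommGroup E] [NormedSpace ℂ E]

/-- The projection onto the eigenspace for `1` of an involution. -/
def signProj (G : E →L[ℂ] E) : E →L[ℂ] E := (1 / 2 : ℂ) • (1 + G)

theorem signProj_apply (G : E →L[ℂ] E) (x : E) : signProj G x = (1 / 2 : ℂ) • (x + G x) := rfl

theorem signProj_add_neg (G : E →L[ℂ] E) : signProj G + signProj (-G) = 1 := by
  simp only [signProj]
  module

theorem mem_range_signProj {G : E →L[ℂ] E} (hG : G * G = 1) {u : E} :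
    u ∈ (signProj G).range ↔ G u = u := by
  constructor
  · rintro ⟨x, rfl⟩
    change G (signProj G x) = signProj G x
    have : G (G x) = x := DFunLike.congr_fun hG x
    rw [signProj_apply, map_smul, map_add, this, add_comm]
  · intro hu
    refine ⟨u, ?_⟩
    change signProj G u = u
    rw [signProj_apply, hu, ← two_smul ℂ, smul_smul]
    norm_num

end SignProj

section Sign

variable {E : Type*} [NormedAddCommGroup E] [InnerProductSpace ℂ E]

/-- `G` is a bounded involution whose eigenspaces for `1` and `-1` lie in the cones around the
ranges of `P` and `1 - P` given by `s`. -/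
structure IsConeSign (P G : E →L[ℂ] E) (s : ℝ) : Prop where
  sq : G * G = 1
  pos : ∀ x, ‖(x + G x) - P (x + G x)‖ ≤ s * ‖P (x + G x)‖
  neg : ∀ x, ‖P (x - G x)‖ ≤ s * ‖(x - G x) - P (x - G x)‖

variable {P G : E →L[ℂ] E} {s : ℝ}

theorem IsConeSign.swap (h : IsConeSign P G s) : IsConeSign (1 - P) (-G) s where
  sq := by rw [neg_mul_neg, h.sq]
  pos x := by
    have := h.neg x
    change ‖(x + -G x) - ((x + -G x) - P (x + -G x))‖ ≤ s * ‖(x + -G x) - P (x + -G x)‖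
    rwa [← sub_eq_add_neg, sub_sub_cancel]
  neg x := by
    have := h.pos x
    change ‖(x - -G x) - P (x - -G x)‖ ≤ s * ‖(x - -G x) - ((x - -G x) - P (x - -G x))‖
    rwa [sub_neg_eq_add, sub_sub_cancel]

theorem IsConeSign.apply_apply (h : IsConeSign P G s) (x : E) : G (G x) = x :=
  DFunLike.congr_fun h.sq x

theorem IsConeSign.signProj_idem (h : IsConeSign P G s) : signProj G * signProj G = signProj G := by
  ext x
  simp only [opMul_apply, signProj_apply, map_smul, map_add, h.apply_apply]
  module

theorem IsConeSign.norm_sub_le (h : IsConeSign P G s) {u : E} (hu : G u = u) :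
    ‖u - P u‖ ≤ s * ‖P u‖ := by
  have := h.pos u
  rw [hu, ← two_smul ℂ u, map_smul, ← smul_sub, norm_smul, norm_smul, Complex.norm_ofNat] at this
  linarith

variable [CompleteSpace E]

/-- Write x = (y + z)/2 and Gx = (y - z)/2 with y, z in the opposite cones. J is positive on the
cone of y and negative on that of z, and the mixed terms cancel in the real part. -/
theorem IsConeSign.re_coercive (h : IsConeSign P G s) (hP : IsStarProjection P) (hs0 : 0 ≤ s)
    (hs1 : s < 1) (x : E) :
    (1 - s ^ 2) / 4 * ‖x‖ ^ 2 ≤ (⟪weighted P 1 1 x, G x⟫_ℂ).re := by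
  have hp := h.pos x
  have hm := h.neg x
  set y := x + G x with hy
  set z := x - G x with hz
  have ex : x = (1 / 2 : ℝ) • (y + z) := by rw [hy, hz]; module
  have eG : G x = (1 / 2 : ℝ) • (y - z) := by rw [hy, hz]; module
  clear_value y z
  have hcross : (⟪weighted P 1 1 z, y⟫_ℂ).re = (⟪weighted P 1 1 y, z⟫_ℂ).re := by
    rw [inner_weighted_left hP, ← inner_conj_symm, Complex.conj_re]
  have key : (⟪weighted P 1 1 x, G x⟫_ℂ).re =
      1 / 4 * ((‖P y‖ ^ 2 - ‖y - P y‖ ^ 2) - (‖P z‖ ^ 2 - ‖z - P z‖ ^ 2)) := by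
    have h1 := re_inner_weighted_self hP 1 1 y
    have h2 := re_inner_weighted_self hP 1 1 z
    rw [eG]
    conv_lhs => rw [ex]
    rw [← Complex.coe_smul, ← Complex.coe_smul, map_smul, map_add, inner_smul_left,
      inner_smul_right, Complex.conj_ofReal, Complex.re_ofReal_mul, Complex.re_ofReal_mul,
      inner_add_left, inner_sub_right, inner_sub_right]
    simp only [Complex.add_re, Complex.sub_re, h1, h2, hcross]
    ring
  have hn : ‖x‖ ^ 2 ≤ 1 / 2 * (‖y‖ ^ 2 + ‖z‖ ^ 2) := by
    have e1 : ‖x‖ = 1 / 2 * ‖y + z‖ := by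
      rw [ex, norm_smul]; norm_num
    have e2 := norm_add_le y z
    rw [e1]
    nlinarith [sq_nonneg (‖y‖ - ‖z‖), norm_nonneg (y + z), norm_nonneg y, norm_nonneg z]
  rw [key]
  rw [norm_sq_eq_proj hP y, norm_sq_eq_proj hP z] at hn
  have hp2 : ‖y - P y‖ ^ 2 ≤ s ^ 2 * ‖P y‖ ^ 2 := by
    rw [← mul_pow]; exact pow_le_pow_left₀ (norm_nonneg _) hp 2
  have hm2 : ‖P z‖ ^ 2 ≤ s ^ 2 * ‖z - P z‖ ^ 2 := by
    rw [← mul_pow]; exact pow_le_pow_left₀ (norm_nonneg _) hm 2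
  have hs2 : s ^ 2 ≤ 1 := by nlinarith
  have h1 := mul_le_mul_of_nonneg_left hn (by linarith : 0 ≤ 1 - s ^ 2)
  have h2 : 0 ≤ 3 - s ^ 2 := by linarith
  have k1 := mul_nonneg h2 (sub_nonneg.2 hp2)
  have k2 := mul_nonneg h2 (sub_nonneg.2 hm2)
  have k3 := mul_nonneg (sq_nonneg (1 - s ^ 2)) (sq_nonneg ‖P y‖)
  have k4 := mul_nonneg (sq_nonneg (1 - s ^ 2)) (sq_nonneg ‖z - P z‖)
  linarith

/-- The restriction of `P` to the range of `signProj G` has a right inverse. -/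
theorem IsConeSign.exists_lift (h : IsConeSign P G s) (hP : IsStarProjection P) (hs0 : 0 ≤ s)
    (hs1 : s < 1) : ∃ L : E →L[ℂ] E, (∀ x, G (L x) = L x) ∧ ∀ x, P (L x) = P x := by
  -- If (J + G)y = Jx, then y + Gy is fixed by G and, because PJ = P, has the same image under P as
  -- x. So it suffices to invert J + G.
  have hu : IsUnit (weighted P 1 1 + G) := by
    refine isUnit_of_re_coercive (isUnit_weighted_one_one hP) (inner_weighted_left hP 1 1) one_pos
      fun x => le_trans ?_ (le_abs_self _)
    have h1 := h.re_coercive hP hs0 hs1 x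
    have h2 : (⟪weighted P 1 1 x, weighted P 1 1 x⟫_ℂ).re = ‖x‖ ^ 2 := by
      rw [inner_self_eq_norm_sq_to_K, norm_weighted_one_one_apply hP]
      norm_cast
    have e : (weighted P 1 1 + G) x = weighted P 1 1 x + G x := rfl
    rw [e, inner_add_right, Complex.add_re, h2]
    nlinarith [mul_nonneg (by nlinarith : 0 ≤ 1 - s ^ 2) (sq_nonneg ‖x‖)]
  have hPJ : ∀ x, P (weighted P 1 1 x) = P x := fun x => by
    rw [weighted_apply, map_sub, map_smul, map_smul, map_sub, proj_proj hP]
    simp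
  set M := Ring.inverse (weighted P 1 1 + G) with hM
  have hMx : ∀ x, weighted P 1 1 (M x) + G (M x) = x := fun x => by
    have := DFunLike.congr_fun (Ring.mul_inverse_cancel _ hu) x
    exact this
  refine ⟨(1 + G) * M * weighted P 1 1, fun x => ?_, fun x => ?_⟩
  · set y := M (weighted P 1 1 x)
    change G (y + G y) = y + G y
    rw [map_add, h.apply_apply, add_comm]
  · set y := M (weighted P 1 1 x) with hy
    change P (y + G y) = P x
    rw [map_add, ← hPJ y, ← map_add, hMx, hPJ]

/-- A small perturbation `T` of `P` maps the range of `signProj G` onto its own range. -/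
theorem IsConeSign.exists_preimage (h : IsConeSign P G s) (hP : IsStarProjection P) (hs0 : 0 ≤ s)
    (hs1 : s < 1) {T : E →L[ℂ] E} (hT : T * T = T) {ν : ℝ} (hν : ‖P - T‖ = ν)
    (hνs : (1 + s ^ 2) * ν ^ 2 < 1) {z : E} (hz : T z = z) : ∃ k, G k = k ∧ T k = z := by
  obtain ⟨L, hGL, hPL⟩ := h.exists_lift hP hs0 hs1
  have hν0 : 0 ≤ ν := hν ▸ norm_nonneg _
  have hν1 : ν < 1 := by nlinarith [mul_nonneg (sq_nonneg s) (sq_nonneg ν)]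
  have hd : ∀ x, ‖P x - T x‖ ≤ ν * ‖x‖ := fun x => hν ▸ (P - T).le_opNorm x
  have hLn : ∀ x, ‖L (P x)‖ ≤ Real.sqrt (1 + s ^ 2) * ‖x‖ := fun x => by
    have h1 := h.norm_sub_le (hGL (P x))
    have h2 := norm_sq_eq_proj hP (L (P x))
    rw [hPL, proj_proj hP] at h1 h2
    have h3 := norm_proj_le hP x
    refine abs_le_of_sq_le_sq' ?_ (by positivity) |>.2
    rw [mul_pow, Real.sq_sqrt (by positivity), h2]
    have h4 : ‖P x‖ ^ 2 ≤ ‖x‖ ^ 2 := pow_le_pow_left₀ (norm_nonneg _) h3 2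
    have h5 : ‖L (P x) - P x‖ ^ 2 ≤ s ^ 2 * ‖P x‖ ^ 2 := by
      rw [← mul_pow]; exact pow_le_pow_left₀ (norm_nonneg _) h1 2
    nlinarith [mul_le_mul_of_nonneg_left h4 (by positivity : 0 ≤ 1 + s ^ 2)]
  -- The cone bounds L on the range of P by √(1 + s²). The Neumann series then solves P(T(Lx)) = Pz
  -- with Px = x.
  have hnorm : ‖P * (P - T) * L * P‖ < 1 := by
    refine lt_of_le_of_lt (ContinuousLinearMap.opNorm_le_bound _
      (by positivity : 0 ≤ ν * Real.sqrt (1 + s ^ 2)) fun x => ?_) ?_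
    · refine (norm_proj_le hP _).trans ((hd (L (P x))).trans ?_)
      rw [mul_assoc]
      exact mul_le_mul_of_nonneg_left (hLn x) hν0
    · rw [← Real.sqrt_sq hν0, ← Real.sqrt_mul (sq_nonneg ν), Real.sqrt_lt' one_pos]
      linarith
  have hu := isUnit_one_sub_of_norm_lt_one hnorm
  obtain ⟨x, hx⟩ : ∃ x, (1 - P * (P - T) * L * P) x = P z :=
    ⟨Ring.inverse (1 - P * (P - T) * L * P) (P z), by
      rw [← opMul_apply, Ring.mul_inverse_cancel _ hu, opOne_apply]⟩
  replace hx : x - P (P (L (P x)) - T (L (P x))) = P z := hx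
  have hxP : P x = x := by
    rw [sub_eq_iff_eq_add.1 hx, map_add, proj_proj hP, proj_proj hP]
  have hPT : P (T (L x)) = P z := by
    rw [hxP, map_sub, proj_proj hP, hPL, hxP, sub_sub_cancel] at hx
    exact hx
  refine ⟨L x, hGL x, ?_⟩
  have hTT : ∀ x, T (T x) = T x := fun x => DFunLike.congr_fun hT x
  -- The defect d = z - T(Lx) satisfies Td = d and Pd = 0, so ‖d‖ = ‖Pd - Td‖ ≤ ν‖d‖ with ν < 1.
  have hdiff := hd (z - T (L x))
  rw [map_sub, map_sub, hPT, sub_self, hz, hTT, zero_sub, norm_neg] at hdiff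
  have : ‖z - T (L x)‖ = 0 := by nlinarith [norm_nonneg (z - T (L x))]
  exact (sub_eq_zero.1 (norm_eq_zero.1 this)).symm

omit [CompleteSpace E] in
theorem tan_arctan_add_arcsin {s ν : ℝ} (hs0 : 0 ≤ s) (hν0 : 0 ≤ ν) (hν1 : ν < 1)
    (hangle : Real.arctan s + Real.arcsin ν < Real.pi / 2) :
    0 < Real.sqrt (1 - ν ^ 2) - s * ν ∧ Real.tan (Real.arctan s + Real.arcsin ν) =
      (ν + s * Real.sqrt (1 - ν ^ 2)) / (Real.sqrt (1 - ν ^ 2) - s * ν) := by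
  have h0 : 0 ≤ Real.arctan s + Real.arcsin ν :=
    add_nonneg (Real.arctan_nonneg.2 hs0) (Real.arcsin_nonneg.2 hν0)
  have hr : 0 < Real.sqrt (1 + s ^ 2) := by positivity
  have hcos : Real.cos (Real.arctan s + Real.arcsin ν) =
      (Real.sqrt (1 - ν ^ 2) - s * ν) / Real.sqrt (1 + s ^ 2) := by
    rw [Real.cos_add, Real.cos_arctan, Real.sin_arctan, Real.cos_arcsin,
      Real.sin_arcsin (by linarith) hν1.le]
    ring
  have hsin : Real.sin (Real.arctan s + Real.arcsin ν) =
      (ν + s * Real.sqrt (1 - ν ^ 2)) / Real.sqrt (1 + s ^ 2) := by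
    rw [Real.sin_add, Real.cos_arctan, Real.sin_arctan, Real.cos_arcsin,
      Real.sin_arcsin (by linarith) hν1.le]
    ring
  have hpos := Real.cos_pos_of_mem_Ioo
    (show Real.arctan s + Real.arcsin ν ∈ Set.Ioo (-(Real.pi / 2)) (Real.pi / 2) from
      ⟨by linarith [Real.pi_pos], hangle⟩)
  rw [hcos] at hpos
  have hpos' : 0 < Real.sqrt (1 - ν ^ 2) - s * ν := (div_pos_iff_of_pos_right hr).1 hpos
  refine ⟨hpos', ?_⟩
  rw [Real.tan_eq_sin_div_cos, hsin, hcos]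
  field_simp

/-- With x = Tu, y = u - Tu and c = √(1 - ν²) = cos(arcsin ν), the vectors x and y lie within the
angle arcsin ν of the ranges of P and 1 - P. Inserting this in the cone inequality for u gives (c -
sν)‖y‖ ≤ (ν + sc)‖x‖, and the quotient is the tangent of the sum. -/
theorem IsConeSign.norm_sub_le_tan (h : IsConeSign P G s) (hP : IsStarProjection P) (hs0 : 0 ≤ s)
    {T : E →L[ℂ] E} (hT : T * T = T) {ν : ℝ} (hν : ‖P - T‖ = ν) (hν1 : ν < 1)
    (hangle : Real.arctan s + Real.arcsin ν < Real.pi / 2) {u : E} (hu : G u = u) :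
    ‖u - T u‖ ≤ Real.tan (Real.arctan s + Real.arcsin ν) * ‖T u‖ := by
  have hν0 : 0 ≤ ν := hν ▸ norm_nonneg _
  have hd : ∀ x, ‖P x - T x‖ ≤ ν * ‖x‖ := fun x => hν ▸ (P - T).le_opNorm x
  obtain ⟨hpos, htan⟩ := tan_arctan_add_arcsin hs0 hν0 hν1 hangle
  have hTT : ∀ x, T (T x) = T x := fun x => DFunLike.congr_fun hT x
  have hux := h.norm_sub_le hu
  have hx := hd (T u)
  have hy := hd (u - T u)
  rw [hTT, norm_sub_rev] at hx
  rw [map_sub T, hTT, sub_self, sub_zero] at hy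
  have hx2 := norm_sq_eq_proj hP (T u)
  have hy2 := norm_sq_eq_proj hP (u - T u)
  have hsum : T u + (u - T u) = u := add_sub_cancel _ _
  set x := T u with hxdef
  set y := u - x with hydef
  have i1 : ‖y - P y‖ - ‖x - P x‖ ≤ ‖u - P u‖ := by
    have := norm_sub_norm_le (y - P y) (-(x - P x))
    rw [norm_neg, sub_neg_eq_add] at this
    refine this.trans_eq ?_
    congr 1
    rw [← hsum, map_add]
    abel
  have i2 : ‖P u‖ ≤ ‖P x‖ + ‖P y‖ := by
    rw [← hsum, map_add]
    exact norm_add_le _ _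
  set c := Real.sqrt (1 - ν ^ 2) with hc
  have hc2 : c ^ 2 = 1 - ν ^ 2 := Real.sq_sqrt (by nlinarith)
  have hc0 : 0 < c := Real.sqrt_pos.2 (by nlinarith)
  have i3 : c * ‖P x‖ + ν * ‖x - P x‖ ≤ ‖x‖ := by
    refine abs_le_of_sq_le_sq' ?_ (norm_nonneg x) |>.2
    rw [hx2]
    nlinarith [sq_nonneg (ν * ‖P x‖ - c * ‖x - P x‖)]
  have i4 : c * ‖y‖ ≤ ‖y - P y‖ := by
    refine abs_le_of_sq_le_sq' ?_ (norm_nonneg _) |>.2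
    have : ‖P y‖ ^ 2 ≤ ν ^ 2 * ‖y‖ ^ 2 := by
      rw [← mul_pow]; exact pow_le_pow_left₀ (norm_nonneg _) hy 2
    rw [mul_pow, hc2]
    linarith
  -- Multiplied by c, the left side is s(c‖Px‖ + ν‖x - Px‖) + (c - sν)‖x - Px‖. The bracket is at
  -- most ‖x‖ by Cauchy–Schwarz, and the last norm at most ν‖x‖.
  have i5 : ‖x - P x‖ + s * ‖P x‖ ≤ (ν + s * c) * ‖x‖ := by
    refine le_of_mul_le_mul_left ?_ hc0
    have j1 := mul_le_mul_of_nonneg_left i3 hs0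
    have j2 := mul_le_mul_of_nonneg_left hx hpos.le
    have j3 : c * ((ν + s * c) * ‖x‖) = (c * ν + s * c ^ 2) * ‖x‖ := by ring
    rw [j3, hc2]
    linarith
  rw [htan, div_mul_eq_mul_div, le_div_iff₀ hpos]
  have i6 := mul_le_mul_of_nonneg_left i2 hs0
  have i7 := mul_le_mul_of_nonneg_left hy hs0
  linarith

/-- The range of `signProj G` is the graph of an operator from the range of `T` to the range of
the complementary projection. -/
theorem IsConeSign.exists_graph (h : IsConeSign P G s) (hP : IsStarProjection P) (hs0 : 0 ≤ s)
    (hs1 : s < 1) {T T' : E →L[ℂ] E} (hT : T * T = T) (hTT' : T + T' = 1) {ν : ℝ}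
    (hν : ‖P - T‖ = ν) (hν1 : ν < 1)
    (hangle : Real.arctan s + Real.arcsin ν < Real.pi / 2) :
    ∃ e : (signProj G).range ≃L[ℂ] T.range,
      (e : (signProj G).range →L[ℂ] T.range) = restr T (signProj G).range ∧
      ((signProj G).range : Set E) = {z | ∃ x : T.range, z = (x : E) +
        ((restr T' (signProj G).range ∘L (e.symm : T.range →L[ℂ] (signProj G).range)) x : E)} ∧
      ‖restr T' (signProj G).range ∘L (e.symm : T.range →L[ℂ] (signProj G).range)‖ ≤
        Real.tan (Real.arctan s + Real.arcsin ν) := by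
  have hν0 : 0 ≤ ν := hν ▸ norm_nonneg _
  obtain ⟨hpos, htan⟩ := tan_arctan_add_arcsin hs0 hν0 hν1 hangle
  set τ := Real.tan (Real.arctan s + Real.arcsin ν) with hτ
  have hτ0 : 0 ≤ τ := by rw [htan]; positivity
  -- The square of sν < √(1 - ν²), that is, of positivity of the cosine of the total angle.
  have hνs : (1 + s ^ 2) * ν ^ 2 < 1 := by
    have hc2 : Real.sqrt (1 - ν ^ 2) ^ 2 = 1 - ν ^ 2 := Real.sq_sqrt (by nlinarith)
    nlinarith [mul_nonneg hs0 hν0, Real.sqrt_nonneg (1 - ν ^ 2)]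
  have hTT : ∀ x, T (T x) = T x := fun x => DFunLike.congr_fun hT x
  have hT' : ∀ x, T' x = x - T x := fun x => by
    have : T x + T' x = x := DFunLike.congr_fun hTT' x
    exact eq_sub_of_add_eq' this
  have hbd : ∀ u, G u = u → ‖u - T u‖ ≤ τ * ‖T u‖ := fun u hu =>
    h.norm_sub_le_tan hP hs0 hT hν hν1 hangle hu
  have hbd' : ∀ u, G u = u → ‖u‖ ≤ (1 + τ) * ‖T u‖ := fun u hu => by
    have h1 := norm_add_le (T u) (u - T u)
    rw [add_sub_cancel] at h1
    linarith [hbd u hu]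
  have hmem : ∀ u : (signProj G).range, G u = u := fun u => (mem_range_signProj h.sq).1 u.2
  have hbij : Function.Bijective (restr T (signProj G).range) := by
    constructor
    · refine (injective_iff_map_eq_zero _).2 fun u hu => ?_
      have h1 : T u = 0 := congrArg Subtype.val hu
      have h2 := hbd' u (hmem u)
      rw [h1, norm_zero, mul_zero] at h2
      exact Subtype.ext (norm_le_zero_iff.1 h2)
    · rintro ⟨z, w, rfl⟩
      obtain ⟨k, hk, hkz⟩ := h.exists_preimage hP hs0 hs1 hT hν hνs (hTT w)
      exact ⟨⟨k, (mem_range_signProj h.sq).2 hk⟩, Subtype.ext hkz⟩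
  let e₀ := LinearEquiv.ofBijective
    ((restr T (signProj G).range : (signProj G).range →L[ℂ] T.range) :
      (signProj G).range →ₗ[ℂ] T.range) hbij
  let e : (signProj G).range ≃L[ℂ] T.range := e₀.toContinuousLinearEquivOfBounds
    ‖restr T (signProj G).range‖ (1 + τ) (fun u => (restr T (signProj G).range).le_opNorm u)
    (fun x => by
      have h1 : T (e₀.symm x : E) = x := congrArg Subtype.val (e₀.apply_symm_apply x)
      have h2 := hbd' (e₀.symm x) (hmem _)
      rw [h1] at h2
      exact h2)
  have he : ∀ u : (signProj G).range, (e u : E) = T u := fun u => rfl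
  have hes : ∀ x : T.range, T (e.symm x : E) = x := fun x =>
    congrArg Subtype.val (e.apply_symm_apply x)
  have hX : ∀ x : T.range, ((restr T' (signProj G).range ∘L
      (e.symm : T.range →L[ℂ] (signProj G).range)) x : E) = (e.symm x : E) - x := fun x => by
    change T' (e.symm x : E) = _
    rw [hT', hes]
  refine ⟨e, ContinuousLinearMap.ext fun u => rfl, ?_, ?_⟩
  · ext z
    constructor
    · intro hz
      refine ⟨e ⟨z, hz⟩, ?_⟩
      rw [hX, e.symm_apply_apply]
      simp
    · rintro ⟨x, rfl⟩
      rw [hX, add_sub_cancel]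
      exact (e.symm x).2
  · refine ContinuousLinearMap.opNorm_le_bound _ hτ0 fun x => ?_
    have := hbd _ (hmem (e.symm x))
    rw [hes, ← hX] at this
    exact this

end Sign

/-! ### Part: unbounded inverses of bounded injective operators, and their resolvents. -/

section BoundedInverse

variable {E : Type*} [NormedAddCommGroup E] [NormedSpace ℂ E]

/-- The unbounded inverse of a bounded operator. -/
def boundedInverse (S : E →L[ℂ] E) : E →ₗ.[ℂ] E := ((S : E →ₗ[ℂ] E).toPMap ⊤).inverse

variable {S : E →L[ℂ] E} (hS : Function.Injective S)

include hS

theorem mem_graph_boundedInverse {p : E × E} : p ∈ (boundedInverse S).graph ↔ S p.2 = p.1 := by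
  have hker : LinearMap.ker ((S : E →ₗ[ℂ] E).toPMap ⊤).toFun = ⊥ :=
    LinearMap.ker_eq_bot.2 fun x y hxy => Subtype.ext (hS hxy)
  rw [boundedInverse, LinearPMap.inverse_graph hker]
  constructor
  · rintro ⟨q, hq, rfl⟩
    obtain ⟨y, hy1, hy2⟩ := (LinearPMap.mem_graph_iff _).1 hq
    change S q.1 = q.2
    rw [← hy1, ← hy2]
    rfl
  · intro h
    refine ⟨(p.2, p.1), (LinearPMap.mem_graph_iff _).2 ⟨⟨p.2, trivial⟩, rfl, h⟩, rfl⟩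

theorem mem_domain_boundedInverse (x : E) : S x ∈ (boundedInverse S).domain :=
  LinearPMap.mem_domain_of_mem_graph ((mem_graph_boundedInverse hS (p := (S x, x))).2 rfl)

theorem apply_boundedInverse (u : (boundedInverse S).domain) : S (boundedInverse S u) = u :=
  (mem_graph_boundedInverse hS).1 ((boundedInverse S).mem_graph u)

theorem boundedInverse_apply (x : E) (h : S x ∈ (boundedInverse S).domain) :
    boundedInverse S ⟨S x, h⟩ = x := hS (apply_boundedInverse hS _)

theorem exists_eq_of_mem_domain {u : E} (hu : u ∈ (boundedInverse S).domain) : ∃ x, S x = u :=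
  ⟨_, apply_boundedInverse hS ⟨u, hu⟩⟩

theorem isClosed_boundedInverse : (boundedInverse S).IsClosed := by
  have : ((boundedInverse S).graph : Set (E × E)) = {p | S p.2 = p.1} := by
    ext p
    exact mem_graph_boundedInverse hS
  rw [LinearPMap.IsClosed, this]
  exact isClosed_eq (S.continuous.comp continuous_snd) continuous_fst

theorem dense_domain_boundedInverse (hd : DenseRange S) :
    Dense ((boundedInverse S).domain : Set E) := by
  refine Dense.mono ?_ hd
  rintro _ ⟨x, rfl⟩
  exact mem_domain_boundedInverse hS x

theorem mem_resolventSet_boundedInverse {z : ℂ} (hu : IsUnit (1 - z • S)) :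
    z ∈ resolventSet (boundedInverse S) := by
  have h1 : ∀ x, Ring.inverse (1 - z • S) x - z • S (Ring.inverse (1 - z • S) x) = x := fun x =>
    DFunLike.congr_fun (Ring.mul_inverse_cancel _ hu) x
  have h2 : ∀ x, Ring.inverse (1 - z • S) (x - z • S x) = x := fun x =>
    DFunLike.congr_fun (Ring.inverse_mul_cancel _ hu) x
  refine ⟨S * Ring.inverse (1 - z • S), fun x => ⟨mem_domain_boundedInverse hS _, ?_⟩, fun u => ?_⟩
  · refine Eq.trans ?_ (h1 x)
    congr 1
    exact boundedInverse_apply hS _ _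
  · have h3 := apply_boundedInverse hS u
    set y := boundedInverse S u
    rw [← h3, opMul_apply, h2]

theorem commutesWith_boundedInverse {Q : E →L[ℂ] E} (hc : Commute S Q) :
    CommutesWith (boundedInverse S) Q := by
  rintro ⟨u, hu⟩
  obtain ⟨x, rfl⟩ := exists_eq_of_mem_domain hS hu
  have h : Q (S x) = S (Q x) := DFunLike.congr_fun hc.eq.symm x
  have hm : Q (S x) ∈ (boundedInverse S).domain := h ▸ mem_domain_boundedInverse hS (Q x)
  refine ⟨hm, ?_⟩
  rw [boundedInverse_apply hS]
  refine hS ?_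
  rw [apply_boundedInverse hS, ← h]

/-- On the range of `signProj G` the operator S - μG acts as S - μ, and the resolvent of S⁻¹ at z =
1/μ is -μS(S - μ)⁻¹. On the whole space S - μ itself may fail to be invertible. -/
theorem mem_resolventSet_part_boundedInverse {G : E →L[ℂ] E} (hG : G * G = 1) (hc : Commute S G)
    {z μ : ℂ} (hz : μ * z = 1) (hu : IsUnit (S - μ • G)) :
    z ∈ resolventSet (part (boundedInverse S) (signProj G).range) := by
  have hmem : ∀ {x : E}, x ∈ (signProj G).range ↔ G x = x := mem_range_signProj hG
  set W := Ring.inverse (S - μ • G) with hW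
  have hcG : Commute G W :=
    commute_ringInverse (hc.symm.sub_right ((Commute.refl G).smul_right μ))
  have h1 : ∀ x, S (W x) - μ • G (W x) = x := fun x =>
    DFunLike.congr_fun (Ring.mul_inverse_cancel _ hu) x
  have h2 : ∀ x, W (S x - μ • G x) = x := fun x =>
    DFunLike.congr_fun (Ring.inverse_mul_cancel _ hu) x
  have hGW : ∀ x, G x = x → G (W x) = W x := fun x hx => by
    have : G (W x) = W (G x) := DFunLike.congr_fun hcG.eq x
    rw [this, hx]
  have hGS : ∀ x, G x = x → G (S x) = S x := fun x hx => by
    have : G (S x) = S (G x) := DFunLike.congr_fun hc.eq.symm x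
    rw [this, hx]
  let R₀ : E →L[ℂ] E := S * ((-μ) • W)
  have hR₀ : ∀ x, R₀ x = S (-μ • W x) := fun x => rfl
  have hGμ : ∀ x, G x = x → G (-μ • W x) = -μ • W x := fun x hx => by
    rw [map_smul, hGW x hx]
  let R : (signProj G).range →L[ℂ] (signProj G).range :=
    (R₀ ∘L (signProj G).range.subtypeL).codRestrict _ fun x =>
      hmem.2 (hGS _ (hGμ _ (hmem.1 x.2)))
  refine ⟨R, fun x => ?_, fun u => ?_⟩
  · have hx := hmem.1 x.2
    have hd : S (-μ • W (x : E)) ∈ (boundedInverse S).domain := mem_domain_boundedInverse hS _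
    have hT : boundedInverse S ⟨S (-μ • W (x : E)), hd⟩ = -μ • W x := boundedInverse_apply hS _ _
    refine ⟨⟨hd, ?_⟩, Subtype.ext ?_⟩
    · change boundedInverse S ⟨S (-μ • W (x : E)), hd⟩ ∈ _
      rw [hT]
      exact hmem.2 (hGμ _ hx)
    · change boundedInverse S ⟨S (-μ • W (x : E)), hd⟩ - z • S (-μ • W (x : E)) = x
      rw [hT, map_smul, smul_smul, mul_neg, mul_comm z, hz]
      have := h1 x
      rw [hGW _ hx] at this
      conv_rhs => rw [← this]
      module
  · obtain ⟨⟨u, hu⟩, hd, hT⟩ := u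
    obtain ⟨y, rfl⟩ := exists_eq_of_mem_domain hS hd
    rw [boundedInverse_apply hS] at hT
    have hy := hmem.1 hT
    refine Subtype.ext ?_
    change S (-μ • W (boundedInverse S ⟨S y, hd⟩ - z • S y)) = S y
    rw [boundedInverse_apply hS, ← map_smul]
    congr 1
    have h3 := h2 y
    rw [hy] at h3
    conv_rhs => rw [← h3]
    congr 1
    rw [smul_sub, smul_smul, neg_mul, hz]
    module

end BoundedInverse

/-! ### Part: spectra of the parts of a decomposed operator. -/

section Parts

variable {E : Type*} [NormedAddCommGroup E] [NormedSpace ℂ E] {T : E →ₗ.[ℂ] E}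

theorem resolventSet_subset_part {Q : E →L[ℂ] E} (hQ : Q ∘L Q = Q) (hc : CommutesWith T Q) :
    resolventSet T ⊆ resolventSet (part T Q.range) := by
  rintro z ⟨R, hR1, hR2⟩
  have hmem : ∀ {x : E}, x ∈ Q.range ↔ Q x = x := fun {x} => by
    constructor
    · rintro ⟨y, rfl⟩
      exact DFunLike.congr_fun hQ y
    · exact fun hx => ⟨x, hx⟩
  have hcomm : ∀ x, R (Q x) = Q (R x) := fun x => by
    obtain ⟨h1, h2⟩ := hR1 x
    obtain ⟨h3, h4⟩ := hc ⟨R x, h1⟩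
    have h5 := hR2 ⟨Q (R x), h3⟩
    rw [h4] at h5
    change R (Q (T ⟨R x, h1⟩) - z • Q (R x)) = Q (R x) at h5
    rw [← map_smul, ← map_sub, h2] at h5
    exact h5
  have hRm : ∀ x : Q.range, R x ∈ Q.range := fun x => by
    rw [hmem, ← hcomm, hmem.1 x.2]
  refine ⟨(R ∘L Q.range.subtypeL).codRestrict _ hRm, fun x => ?_, fun u => ?_⟩
  · obtain ⟨h1, h2⟩ := hR1 x
    have h3 : T ⟨R x, h1⟩ ∈ Q.range := by
      rw [sub_eq_iff_eq_add.1 h2]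
      exact add_mem x.2 (Submodule.smul_mem _ _ (hRm x))
    exact ⟨⟨h1, h3⟩, Subtype.ext h2⟩
  · obtain ⟨⟨u, hu⟩, hd, hT⟩ := u
    exact Subtype.ext (hR2 ⟨u, hd⟩)

theorem mem_resolventSet_of_parts {Qp Qm : E →L[ℂ] E} (h : IsDecomposedBy T Qp Qm) {z : ℂ}
    (hp : z ∈ resolventSet (part T Qp.range)) (hm : z ∈ resolventSet (part T Qm.range)) :
    z ∈ resolventSet T := by
  obtain ⟨Rp, hp1, hp2⟩ := hp
  obtain ⟨Rm, hm1, hm2⟩ := hm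
  obtain ⟨hQ, hcp, hcm⟩ := h
  have hadd : ∀ x, Qp x + Qm x = x := fun x => DFunLike.congr_fun hQ.add_eq x
  refine ⟨Qp.range.subtypeL ∘L Rp ∘L Qp.codRestrict Qp.range (fun x => ⟨x, rfl⟩) +
    Qm.range.subtypeL ∘L Rm ∘L Qm.codRestrict Qm.range (fun x => ⟨x, rfl⟩), fun x => ?_, fun u => ?_⟩
  · obtain ⟨⟨a1, a2⟩, a3⟩ := hp1 ⟨Qp x, x, rfl⟩
    obtain ⟨⟨b1, b2⟩, b3⟩ := hm1 ⟨Qm x, x, rfl⟩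
    have a4 := congrArg Subtype.val a3
    have b4 := congrArg Subtype.val b3
    refine ⟨T.domain.add_mem a1 b1, ?_⟩
    have e := T.map_add ⟨_, a1⟩ ⟨_, b1⟩
    refine Eq.trans ?_ (hadd x)
    refine Eq.trans ?_ (congrArg₂ (· + ·) a4 b4)
    refine (congrArg₂ (· - ·) e (smul_add z _ _)).trans ?_
    exact add_sub_add_comm _ _ _ _
  · obtain ⟨a1, a2⟩ := hcp u
    obtain ⟨b1, b2⟩ := hcm u
    have a3 := hp2 ⟨⟨Qp u, (u : E), rfl⟩, a1, by rw [a2]; exact ⟨T u, rfl⟩⟩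
    have b3 := hm2 ⟨⟨Qm u, (u : E), rfl⟩, b1, by rw [b2]; exact ⟨T u, rfl⟩⟩
    have hmp : ∀ y, Qp y ∈ Qp.range := fun y => ⟨y, rfl⟩
    have hmm : ∀ y, Qm y ∈ Qm.range := fun y => ⟨y, rfl⟩
    have a4 : (⟨Qp (T u - z • (u : E)), hmp _⟩ : Qp.range) =
        part T Qp.range ⟨⟨Qp u, hmp u⟩, a1, by rw [a2]; exact hmp _⟩ - z • ⟨Qp u, hmp u⟩ :=
      Subtype.ext (((map_sub Qp _ _).trans (congrArg₂ (· - ·) a2.symm (map_smul Qp _ _))))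
    have b4 : (⟨Qm (T u - z • (u : E)), hmm _⟩ : Qm.range) =
        part T Qm.range ⟨⟨Qm u, hmm u⟩, b1, by rw [b2]; exact hmm _⟩ - z • ⟨Qm u, hmm u⟩ :=
      Subtype.ext (((map_sub Qm _ _).trans (congrArg₂ (· - ·) b2.symm (map_smul Qm _ _))))
    replace a3 := (congrArg Rp a4).trans a3
    replace b3 := (congrArg Rm b4).trans b3
    have a5 := congrArg Subtype.val a3
    have b5 := congrArg Subtype.val b3
    exact (congrArg₂ (· + ·) a5 b5).trans (hadd u)

/-- If the parts of `T` have no spectrum in the wrong half-planes, they split the spectrum. -/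
theorem spectrum_part_eq {Qp Qm : E →L[ℂ] E} (h : IsDecomposedBy T Qp Qm) {M : Set ℂ}
    (hp : ∀ z ∉ M, z ∈ resolventSet (part T Qp.range))
    (hm : ∀ z ∈ M, z ∈ resolventSet (part T Qm.range)) :
    spectrum (part T Qp.range) = spectrum T ∩ M := by
  ext z
  constructor
  · intro hz
    exact ⟨fun hz' => hz (resolventSet_subset_part h.1.idem_p h.2.1 hz'),
      not_not.1 fun hz' => hz (hp z hz')⟩
  · rintro ⟨hz, hzM⟩ hz'
    exact hz (mem_resolventSet_of_parts h hz' (hm z hzM))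

theorem IsDecomposedBy.swap {Qp Qm : E →L[ℂ] E} (h : IsDecomposedBy T Qp Qm) :
    IsDecomposedBy T Qm Qp :=
  ⟨⟨h.1.idem_m, h.1.idem_p, by rw [add_comm]; exact h.1.add_eq⟩, h.2.2, h.2.1⟩

end Parts

/-! ### Part: location of the spectra of the two parts. -/

section Coercive

variable {E : Type*} [NormedAddCommGroup E] [InnerProductSpace ℂ E] [CompleteSpace E]
  {P G S : E →L[ℂ] E} {s : ℝ}

/-- For Z = J + G*JG the number ⟨Zx, Gx⟩ = 2 Re⟨Jx, Gx⟩ is real and positive for x ≠ 0, so μ acts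
only through Re μ. Since S commutes with G, it is accretive for Z as well, being so for J at x and
at Gx. -/
theorem IsConeSign.isUnit_sub_smul (h : IsConeSign P G s) (hP : IsStarProjection P) (hs0 : 0 ≤ s)
    (hs1 : s < 1) (hc : Commute S G) (hacc : ∀ x, 0 ≤ (⟪weighted P 1 1 x, S x⟫_ℂ).re) {μ : ℂ}
    (hμ : μ.re < 0) : IsUnit (S - μ • G) := by
  set J := weighted P 1 1 with hJ
  set Z : E →L[ℂ] E := J + ContinuousLinearMap.adjoint G * J * G with hZ
  have hJs := inner_weighted_left hP 1 1
  have hZl : ∀ x y, ⟪Z x, y⟫_ℂ = ⟪J x, y⟫_ℂ + ⟪J (G x), G y⟫_ℂ := fun x y => by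
    rw [← ContinuousLinearMap.adjoint_inner_left G, ← inner_add_left]
    rfl
  have hZs : ∀ x y, ⟪Z x, y⟫_ℂ = ⟪x, Z y⟫_ℂ := fun x y => by
    rw [hZl, hJs, hJs, ← inner_conj_symm x (Z y), hZl, map_add, inner_conj_symm, inner_conj_symm]
  have hZG : ∀ x, ⟪Z x, G x⟫_ℂ = ((2 * (⟪J x, G x⟫_ℂ).re : ℝ) : ℂ) := fun x => by
    rw [hZl, h.apply_apply, hJs (G x) x, ← inner_conj_symm (G x), Complex.add_conj]
  have hs2 : 0 < 1 - s ^ 2 := by nlinarith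
  have hco := h.re_coercive hP hs0 hs1
  have hG : IsUnit G := ⟨⟨G, G, h.sq, h.sq⟩, rfl⟩
  have hZu : IsUnit Z := by
    have : IsUnit (Z * G) := by
      refine ContinuousLinearMap.isUnit_of_forall_le_norm_inner_map _
        (c := ⟨(1 - s ^ 2) / 2, by linarith⟩) (show 0 < (1 - s ^ 2) / 2 by linarith) fun x => ?_
      rw [opMul_apply, hZs, norm_inner_symm, hZG, Complex.norm_real]
      refine le_trans ?_ (le_abs_self _)
      change ‖x‖ ^ 2 * ((1 - s ^ 2) / 2) ≤ _
      linarith [hco x]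
    have h2 := this.mul hG
    rwa [mul_assoc, h.sq, mul_one] at h2
  refine isUnit_of_re_coercive hZu hZs (c := -μ.re * ((1 - s ^ 2) / 2))
    (mul_pos (neg_pos.2 hμ) (by linarith)) fun x => le_trans ?_ (le_abs_self _)
  have hSG : G (S x) = S (G x) := DFunLike.congr_fun hc.eq.symm x
  have e : (S - μ • G) x = S x - μ • G x := rfl
  rw [e, inner_sub_right, inner_smul_right, hZG, Complex.sub_re, Complex.re_mul_ofReal, hZl,
    Complex.add_re, hSG]
  have h1 := hacc x
  have h2 := hacc (G x)
  have h3 := mul_le_mul_of_nonneg_left (hco x) (neg_nonneg.2 hμ.le)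
  linarith

end Coercive

/-! ### Part: S⁻¹ is the associated operator, and its decomposition. -/

section Association

variable {E : Type*} [NormedAddCommGroup E] [InnerProductSpace ℂ E] [CompleteSpace E]
  {A P V : E →L[ℂ] E} {ρ : ℝ} (h : IsBlockSmall A P V ρ)
  {q : SesqForm (boundedInverse A).domain}
  (hq : ∀ u w, q u w = ⟪boundedInverse A w, formOp P V (boundedInverse A u)⟫_ℂ)

include h

theorem IsBlockSmall.domain_le :
    (boundedInverse (assocInv A P V)).domain ≤ (boundedInverse A).domain := by
  intro u hu
  obtain ⟨x, rfl⟩ := exists_eq_of_mem_domain h.injective_assocInv hu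
  exact mem_domain_boundedInverse h.inj _

theorem IsBlockSmall.adjoint_inverse_inner (x y : E) :
    ⟪ContinuousLinearMap.adjoint (Ring.inverse (formOp P V)) x, formOp P V y⟫_ℂ = ⟪x, y⟫_ℂ := by
  rw [ContinuousLinearMap.adjoint_inner_left, h.inverse_apply_formOp]

/-- H* is inverted by A(B⁻¹)*A, which places its domain in the range of A, the form domain. -/
theorem IsBlockSmall.adjoint_eq (w : (boundedInverse (assocInv A P V)).adjoint.domain) :
    A (ContinuousLinearMap.adjoint (Ring.inverse (formOp P V))
      (A ((boundedInverse (assocInv A P V)).adjoint w))) = w := by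
  refine ext_inner_right ℂ fun x => ?_
  have h1 := LinearPMap.adjoint_isFormalAdjoint
    (dense_domain_boundedInverse h.injective_assocInv h.denseRange_assocInv) w
    ⟨_, mem_domain_boundedInverse h.injective_assocInv x⟩
  rw [boundedInverse_apply h.injective_assocInv] at h1
  rw [← h1, h.inner_left, ContinuousLinearMap.adjoint_inner_left, h.inner_left]
  rfl

include hq

theorem IsBlockSmall.isAssociated : IsAssociated (boundedInverse (assocInv A P V)) q where
  closed := isClosed_boundedInverse h.injective_assocInv
  dense := dense_domain_boundedInverse h.injective_assocInv h.denseRange_assocInv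
  dom_le := h.domain_le
  adjoint_dom_le := by
    intro w hw
    have := mem_domain_boundedInverse h.inj (ContinuousLinearMap.adjoint
      (Ring.inverse (formOp P V)) (A ((boundedInverse (assocInv A P V)).adjoint ⟨w, hw⟩)))
    rwa [h.adjoint_eq ⟨w, hw⟩] at this
  eq_left := by
    rintro ⟨u, hu⟩ w
    obtain ⟨x, rfl⟩ := exists_eq_of_mem_domain h.injective_assocInv hu
    have e : boundedInverse A ⟨assocInv A P V x, h.domain_le hu⟩ =
        Ring.inverse (formOp P V) (A x) := boundedInverse_apply h.inj _ _
    rw [hq, boundedInverse_apply h.injective_assocInv, e, h.inverse_formOp_apply, ← h.inner_left,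
      apply_boundedInverse h.inj]
  eq_right := by
    intro u w
    have e : ∀ hw : (w : E) ∈ (boundedInverse A).domain, boundedInverse A ⟨w, hw⟩ =
        ContinuousLinearMap.adjoint (Ring.inverse (formOp P V))
          (A ((boundedInverse (assocInv A P V)).adjoint w)) := fun hw =>
      h.inj (by rw [apply_boundedInverse h.inj, h.adjoint_eq])
    rw [hq, e, h.adjoint_inverse_inner, h.inner_left, apply_boundedInverse h.inj]

/-- The first representation identity gives SHu = u, so H is a restriction of S⁻¹. The second makes
H* injective, so H has dense range, and closedness extends (Sy, y) ∈ graph H from that range to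
every y. -/
theorem IsBlockSmall.eq_of_isAssociated {H : E →ₗ.[ℂ] E} (hH : IsAssociated H q) :
    H = boundedInverse (assocInv A P V) := by
  have hleft : ∀ u : H.domain, assocInv A P V (H u) = u := fun u => by
    have h1 : A (H u) = formOp P V (boundedInverse A ⟨u, hH.dom_le u.2⟩) := by
      refine ext_inner_left ℂ fun y => ?_
      have := hH.eq_left u ⟨_, mem_domain_boundedInverse h.inj y⟩
      rw [hq, boundedInverse_apply h.inj] at this
      rw [← this, h.inner_left]
    change A (Ring.inverse (formOp P V) (A (H u))) = u
    rw [h1, h.inverse_apply_formOp, apply_boundedInverse h.inj]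
  have hright : ∀ w : H.adjoint.domain, H.adjoint w = 0 → (w : E) = 0 := fun w hw => by
    have h1 : boundedInverse A ⟨w, hH.adjoint_dom_le w.2⟩ = 0 := by
      refine ext_inner_right ℂ fun x => ?_
      have := hH.eq_right ⟨_, mem_domain_boundedInverse h.inj (Ring.inverse (formOp P V) x)⟩ w
      rw [hq, boundedInverse_apply h.inj, h.inverse_formOp_apply, hw, inner_zero_left] at this
      rw [← this, inner_zero_left]
    have h2 := apply_boundedInverse h.inj ⟨(w : E), hH.adjoint_dom_le w.2⟩
    rw [h1, map_zero] at h2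
    exact h2.symm
  have hdense : (LinearMap.range H.toFun)ᗮ = ⊥ := by
    refine (Submodule.eq_bot_iff _).2 fun w hw => ?_
    have h0 : ∀ x : H.domain, ⟪(0 : E), x⟫_ℂ = ⟪w, H x⟫_ℂ := fun x => by
      rw [inner_zero_left]
      exact (Submodule.inner_left_of_mem_orthogonal (K := LinearMap.range H.toFun) ⟨x, rfl⟩ hw).symm
    have hd := LinearPMap.mem_adjoint_domain_of_exists w ⟨0, h0⟩
    exact hright ⟨w, hd⟩ (LinearPMap.adjoint_apply_eq hH.dense ⟨w, hd⟩ h0)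
  rw [← Submodule.topologicalClosure_eq_top_iff] at hdense
  have hmem : ∀ y, (assocInv A P V y, y) ∈ H.graph := fun y => by
    have hy : y ∈ closure (LinearMap.range H.toFun : Set E) := by
      have : y ∈ (LinearMap.range H.toFun).topologicalClosure := by rw [hdense]; trivial
      exact this
    have hmap : Set.MapsTo (fun y => (assocInv A P V y, y)) (LinearMap.range H.toFun : Set E)
        (H.graph : Set (E × E)) := by
      rintro _ ⟨u, rfl⟩
      change (assocInv A P V (H u), H u) ∈ H.graph
      rw [hleft]
      exact H.mem_graph u
    have h2 := map_mem_closure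
      ((assocInv A P V).continuous.prodMk continuous_id) hy hmap
    rwa [IsClosed.closure_eq hH.closed] at h2
  refine LinearPMap.eq_of_eq_graph (Submodule.ext fun p => ?_)
  rw [mem_graph_boundedInverse h.injective_assocInv]
  constructor
  · intro hp
    obtain ⟨u, hu1, hu2⟩ := (LinearPMap.mem_graph_iff _).1 hp
    rw [← hu1, ← hu2, hleft]
  · intro hp
    have := hmem p.2
    rwa [hp] at this

omit hq

/-- |H₀|^{1/2} maps ran S onto the dense range of B⁻¹A. As its inverse A is bounded, density of the
images gives density in the graph. -/
theorem IsBlockSmall.hasCore :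
    (boundedInverse A).HasCore (boundedInverse (assocInv A P V)).domain := by
  refine ⟨h.domain_le, ?_⟩
  have hle : (boundedInverse A).domRestrict (boundedInverse (assocInv A P V)).domain ≤
      boundedInverse A := LinearPMap.domRestrict_le
  have hcl : ((boundedInverse A).domRestrict
      (boundedInverse (assocInv A P V)).domain).IsClosable :=
    (isClosed_boundedInverse h.inj).isClosable.leIsClosable hle
  refine LinearPMap.eq_of_eq_graph ?_
  rw [← hcl.graph_closure_eq_closure_graph]
  refine le_antisymm (Submodule.topologicalClosure_minimal _ (LinearPMap.le_graph_of_le hle)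
    (isClosed_boundedInverse h.inj)) fun p hp => ?_
  rw [mem_graph_boundedInverse h.inj] at hp
  have hy : p.2 ∈ closure (Set.range (Ring.inverse (formOp P V) * A : E →L[ℂ] E)) :=
    (h.denseRange_inverse.comp h.denseRange (Ring.inverse (formOp P V)).continuous) p.2
  have hmap : Set.MapsTo (fun y => (A y, y)) (Set.range (Ring.inverse (formOp P V) * A : E →L[ℂ] E))
      (((boundedInverse A).domRestrict (boundedInverse (assocInv A P V)).domain).graph :
        Set (E × E)) := by
    rintro _ ⟨x, rfl⟩
    have h1 : assocInv A P V x ∈ (boundedInverse (assocInv A P V)).domain :=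
      mem_domain_boundedInverse h.injective_assocInv x
    have h2 := h.domain_le h1
    refine (LinearPMap.mem_graph_iff _).2 ⟨⟨assocInv A P V x, h1, h2⟩, rfl, ?_⟩
    have h3 : (boundedInverse A).domRestrict (boundedInverse (assocInv A P V)).domain
        ⟨assocInv A P V x, h1, h2⟩ = boundedInverse A ⟨assocInv A P V x, h2⟩ :=
      LinearPMap.domRestrict_apply rfl
    rw [h3]
    exact boundedInverse_apply h.inj _ _
  have h4 := map_mem_closure (A.continuous.prodMk continuous_id) hy hmap
  change (A p.2, p.2) ∈ _ at h4
  rw [hp] at h4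
  exact h4

/-- The operators of the decomposition, and the separation of the spectrum. -/
theorem IsBlockSmall.decomposition {G : E →L[ℂ] E} {s : ℝ} (hs0 : 0 ≤ s) (hs1 : s < 1)
    (hG : IsConeSign P G s) (hc : Commute (assocInv A P V) G) :
    IsDecomposedBy (boundedInverse (assocInv A P V)) (signProj G) (signProj (-G)) ∧
    spectrum (part (boundedInverse (assocInv A P V)) (signProj G).range) =
      spectrum (boundedInverse (assocInv A P V)) ∩ {z : ℂ | 0 < z.re} ∧
    spectrum (part (boundedInverse (assocInv A P V)) (signProj (-G)).range) =
      spectrum (boundedInverse (assocInv A P V)) ∩ {z : ℂ | z.re < 0} := by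
  have hSinj := h.injective_assocInv
  have hcs : ∀ {G' : E →L[ℂ] E}, Commute (assocInv A P V) G' →
      Commute (assocInv A P V) (signProj G') := fun hc' =>
    ((Commute.one_right _).add_right hc').smul_right _
  have hcn : Commute (assocInv A P V) (-G) := hc.neg_right
  have hρ := h.lt_half
  have hacc : ∀ x, 0 ≤ (⟪weighted P 1 1 x, assocInv A P V x⟫_ℂ).re := fun x => by
    rw [h.re_inner_weighted_assocInv]
    exact le_trans (by have : 0 ≤ 1 - 2 * ρ := by linarith
                       positivity) (h.le_re_inner_one_one _)
  have hdec : IsDecomposedBy (boundedInverse (assocInv A P V)) (signProj G) (signProj (-G)) :=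
    ⟨⟨hG.signProj_idem, hG.swap.signProj_idem, signProj_add_neg G⟩,
      commutesWith_boundedInverse hSinj (hcs hc), commutesWith_boundedInverse hSinj (hcs hcn)⟩
  have himag : ∀ z : ℂ, z.re = 0 → z ∈ resolventSet (boundedInverse (assocInv A P V)) := by
    intro z hz
    refine mem_resolventSet_boundedInverse hSinj ?_
    have hu := isUnit_add_smul_mul_mul h.isUnit_formOp (c := ((1 : ℝ) : ℂ)) (by simp)
      (h.isUnit_pencil one_ne_zero (-z.im))
    have e : (((-z.im : ℝ) : ℂ) * Complex.I) = -z := by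
      apply Complex.ext <;> simp [hz]
    rwa [e, neg_smul, Complex.ofReal_one, one_smul, ← sub_eq_add_neg] at hu
  have hp : ∀ z : ℂ, z.re < 0 →
      z ∈ resolventSet (part (boundedInverse (assocInv A P V)) (signProj G).range) := by
    intro z hz
    have hz0 : z ≠ 0 := fun h0 => by simp [h0] at hz
    refine mem_resolventSet_part_boundedInverse hSinj hG.sq hc (inv_mul_cancel₀ hz0)
      (hG.isUnit_sub_smul h.proj hs0 hs1 hc hacc ?_)
    rw [Complex.inv_re]
    exact div_neg_of_neg_of_pos hz (Complex.normSq_pos.2 hz0)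
  have hm : ∀ z : ℂ, 0 < z.re →
      z ∈ resolventSet (part (boundedInverse (assocInv A P V)) (signProj (-G)).range) := by
    intro z hz
    have hz0 : z ≠ 0 := fun h0 => by simp [h0] at hz
    refine mem_resolventSet_part_boundedInverse hSinj hG.swap.sq hcn (inv_mul_cancel₀ hz0) ?_
    have := hG.isUnit_sub_smul h.proj hs0 hs1 hc hacc (μ := -z⁻¹) (by
      rw [Complex.neg_re, Complex.inv_re]
      exact neg_neg_of_pos (div_pos hz (Complex.normSq_pos.2 hz0)))
    rwa [neg_smul, ← smul_neg] at this
  -- The coercivity argument needs Re z ≠ 0, so the imaginary axis, including z = 0, is inherited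
  -- from the resolvent set of the whole operator.
  have hp0 : ∀ z : ℂ, z.re ≤ 0 →
      z ∈ resolventSet (part (boundedInverse (assocInv A P V)) (signProj G).range) := fun z hz =>
    hz.lt_or_eq.elim (hp z) fun h0 =>
      resolventSet_subset_part hdec.1.idem_p hdec.2.1 (himag z h0)
  have hm0 : ∀ z : ℂ, 0 ≤ z.re →
      z ∈ resolventSet (part (boundedInverse (assocInv A P V)) (signProj (-G)).range) := fun z hz =>
    hz.lt_or_eq.elim (hm z) fun h0 =>
      resolventSet_subset_part hdec.1.idem_m hdec.2.2 (himag z h0.symm)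
  exact ⟨hdec, spectrum_part_eq hdec (fun z hz => hp0 z (not_lt.1 hz)) fun z hz => hm0 z hz.le,
    spectrum_part_eq hdec.swap (fun z hz => hm0 z (not_lt.1 hz)) fun z hz => hp0 z hz.le⟩

end Association

/-! ### Part: from the self-adjoint operator and the form to A, P and V. -/

section Translation

variable {E : Type*} [NormedAddCommGroup E] [InnerProductSpace ℂ E] [CompleteSpace E]

omit [CompleteSpace E] in
theorem isResolventAt_resolvent {T : E →ₗ.[ℂ] E} {z : ℂ} (hz : z ∈ resolventSet T) :
    IsResolventAt T z (resolvent T z) := by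
  have hz' : ∃ R : E →L[ℂ] E, IsResolventAt T z R := hz
  rw [resolvent, dif_pos hz']
  exact hz'.choose_spec

theorem isSelfAdjoint_of_isResolventAt_zero {H₀ : E →ₗ.[ℂ] E} (hH₀ : IsSelfAdjoint H₀)
    {R : E →L[ℂ] E} (hR : IsResolventAt H₀ 0 R) : IsSelfAdjoint R := by
  have hsym : H₀.IsFormalAdjoint H₀ := by
    have := LinearPMap.adjoint_isFormalAdjoint hH₀.dense_domain
    rwa [LinearPMap.isSelfAdjoint_def.1 hH₀] at this
  refine ContinuousLinearMap.isSelfAdjoint_iff_isSymmetric.2 fun x y => ?_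
  obtain ⟨hx, hx'⟩ := hR.1 x
  obtain ⟨hy, hy'⟩ := hR.1 y
  rw [zero_smul, sub_zero] at hx' hy'
  have := hsym ⟨R x, hx⟩ ⟨R y, hy⟩
  rw [hx', hy'] at this
  exact this.symm

omit [CompleteSpace E] in
theorem injective_of_isResolventAt_zero {H₀ : E →ₗ.[ℂ] E} {R : E →L[ℂ] E}
    (hR : IsResolventAt H₀ 0 R) : Function.Injective R := by
  refine (injective_iff_map_eq_zero R).2 fun x hx => ?_
  obtain ⟨h, h'⟩ := hR.1 x
  rw [zero_smul, sub_zero] at h'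
  rw [← h']
  have : (⟨R x, h⟩ : H₀.domain) = 0 := Subtype.ext hx
  rw [this, H₀.map_zero]

/-- Invariance of U means PAP = AP; taking adjoints gives PAP = PA. -/
theorem commute_starProjection {A : E →L[ℂ] E} (hA : IsSelfAdjoint A) {U : Submodule ℂ E}
    [U.HasOrthogonalProjection] (hU : ∀ x ∈ U, A x ∈ U) : Commute A U.starProjection := by
  have hP : IsSelfAdjoint U.starProjection :=
    isStarProjection_starProjection.isSelfAdjoint
  have h1 : U.starProjection * (A * U.starProjection) = A * U.starProjection :=
    ContinuousLinearMap.ext fun x =>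
      Submodule.starProjection_eq_self_iff.2 (hU _ (Submodule.starProjection_apply_mem U x))
  have h2 := congrArg star h1
  rw [star_mul, star_mul, hA.star_eq, hP.star_eq, mul_assoc, h1] at h2
  exact h2

section

variable (R : E →L[ℂ] E)

theorem sqrt_abs_isSelfAdjoint : IsSelfAdjoint (CFC.sqrt (CFC.abs R)) :=
  IsSelfAdjoint.of_nonneg (CFC.sqrt_nonneg _)

variable {R}

theorem sqrt_abs_injective (hR : IsSelfAdjoint R) (hi : Function.Injective R) :
    Function.Injective (CFC.sqrt (CFC.abs R) : E →L[ℂ] E) := by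
  refine (injective_iff_map_eq_zero _).2 fun x hx => ?_
  have h1 : CFC.abs R x = 0 := by
    rw [← CFC.sqrt_mul_sqrt_self (CFC.abs R) (CFC.abs_nonneg R), opMul_apply, hx, map_zero]
  have h2 : R (R x) = 0 := by
    have h3 : (CFC.abs R * CFC.abs R) x = 0 := by rw [opMul_apply, h1, map_zero]
    rw [CFC.abs_mul_abs, hR.star_eq] at h3
    exact h3
  exact hi (hi (by rw [h2, map_zero, map_zero]))

theorem sqrt_abs_commute (hR : IsSelfAdjoint R) :
    Commute (CFC.sqrt (CFC.abs R)) (CFC.abs R - R) := by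
  have h1 : Commute (CFC.abs R) R := CFC.commute_abs_self R hR.isStarNormal
  have h2 : Commute (CFC.abs R) (CFC.abs R - R) := (Commute.refl _).sub_right h1
  exact h2.cfcₙ_nnreal _

end

theorem commute_absInvSqrt_posProj {H₀ : E →ₗ.[ℂ] E} (hR : IsSelfAdjoint (resolvent H₀ 0)) :
    Commute (absInvSqrt H₀) (posProj H₀) := by
  refine commute_starProjection (sqrt_abs_isSelfAdjoint _) fun x hx => ?_
  have hx' : (CFC.abs (resolvent H₀ 0) - resolvent H₀ 0) x = 0 := hx
  have h := DFunLike.congr_fun (sqrt_abs_commute hR).eq x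
  rw [opMul_apply, opMul_apply, hx', map_zero] at h
  exact h.symm

theorem isStarProjection_posProj (H₀ : E →ₗ.[ℂ] E) : IsStarProjection (posProj H₀) :=
  isStarProjection_starProjection

theorem signOp_eq (H₀ : E →ₗ.[ℂ] E) : signOp H₀ = weighted (posProj H₀) 1 1 := by
  rw [weighted, Complex.ofReal_one, one_smul, one_smul]
  rfl

theorem norm_le_of_formSup_le {H₀ : E →ₗ.[ℂ] E} {D : Submodule ℂ E} {v : SesqForm D} {M : Set E}
    (hM : ∀ c : ℂ, ∀ x ∈ M, c • x ∈ M) {C : ℝ≥0} (h : formSup H₀ v M ≤ C) {x y : E} (hx : x ∈ M)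
    (hy : y ∈ M) (hxD : absInvSqrt H₀ x ∈ D) (hyD : absInvSqrt H₀ y ∈ D) :
    ‖v ⟨absInvSqrt H₀ x, hxD⟩ ⟨absInvSqrt H₀ y, hyD⟩‖ ≤ C * ‖x‖ * ‖y‖ := by
  have hunit : ∀ {x y : E}, x ∈ M → y ∈ M → ‖x‖ = 1 → ‖y‖ = 1 →
      ∀ (hxD : absInvSqrt H₀ x ∈ D) (hyD : absInvSqrt H₀ y ∈ D),
        ‖v ⟨absInvSqrt H₀ x, hxD⟩ ⟨absInvSqrt H₀ y, hyD⟩‖ ≤ C := by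
    intro x y hx hy hx1 hy1 hxD hyD
    have h1 : ‖v ⟨absInvSqrt H₀ x, hxD⟩ ⟨absInvSqrt H₀ y, hyD⟩‖ₑ ≤ C := by
      refine le_trans ?_ h
      exact le_iSup_of_le x <| le_iSup_of_le y <| le_iSup_of_le hx <| le_iSup_of_le hy <|
        le_iSup_of_le hx1 <| le_iSup_of_le hy1 <| le_iSup_of_le hxD <| le_iSup_of_le hyD le_rfl
    rw [enorm_eq_nnnorm, ENNReal.coe_le_coe] at h1
    exact_mod_cast h1
  have hscale : ∀ {x : E}, x ≠ 0 → ∃ x' : E, ‖x'‖ = 1 ∧ x = ((‖x‖ : ℝ) : ℂ) • x' ∧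
      x' = ((‖x‖⁻¹ : ℝ) : ℂ) • x := fun {x} hx0 => by
    have hn : ‖x‖ ≠ 0 := norm_ne_zero_iff.2 hx0
    refine ⟨((‖x‖⁻¹ : ℝ) : ℂ) • x, ?_, ?_, rfl⟩
    · rw [norm_smul, Complex.norm_real, norm_inv, norm_norm, inv_mul_cancel₀ hn]
    · rw [smul_smul, ← Complex.ofReal_mul, mul_inv_cancel₀ hn, Complex.ofReal_one, one_smul]
  by_cases hx0 : x = 0
  · have : (⟨absInvSqrt H₀ x, hxD⟩ : D) = 0 := Subtype.ext ((congrArg (absInvSqrt H₀) hx0).trans (map_zero _))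
    rw [this, map_zero, LinearMap.zero_apply, norm_zero]
    positivity
  by_cases hy0 : y = 0
  · have : (⟨absInvSqrt H₀ y, hyD⟩ : D) = 0 := Subtype.ext ((congrArg (absInvSqrt H₀) hy0).trans (map_zero _))
    rw [this, map_zero, norm_zero]
    positivity
  obtain ⟨x', hx1, hxx, hx'⟩ := hscale hx0
  obtain ⟨y', hy1, hyy, hy'⟩ := hscale hy0
  have hxM : x' ∈ M := hx' ▸ hM _ _ hx
  have hyM : y' ∈ M := hy' ▸ hM _ _ hy
  have hxD' : absInvSqrt H₀ x' ∈ D := by rw [hx', map_smul]; exact D.smul_mem _ hxD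
  have hyD' : absInvSqrt H₀ y' ∈ D := by rw [hy', map_smul]; exact D.smul_mem _ hyD
  have ex : (⟨absInvSqrt H₀ x, hxD⟩ : D) = ((‖x‖ : ℝ) : ℂ) • ⟨absInvSqrt H₀ x', hxD'⟩ :=
    Subtype.ext ((congrArg (absInvSqrt H₀) hxx).trans (map_smul _ _ _))
  have ey : (⟨absInvSqrt H₀ y, hyD⟩ : D) = ((‖y‖ : ℝ) : ℂ) • ⟨absInvSqrt H₀ y', hyD'⟩ :=
    Subtype.ext ((congrArg (absInvSqrt H₀) hyy).trans (map_smul _ _ _))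
  have h1 := hunit hxM hyM hx1 hy1 hxD' hyD'
  rw [ex, ey, map_smul v, LinearMap.smul_apply, LinearMap.map_smulₛₗ, norm_smul, norm_smul,
    Complex.norm_real, norm_norm, Complex.conj_ofReal, Complex.norm_real, norm_norm]
  calc ‖x‖ * (‖y‖ * _) ≤ ‖x‖ * (‖y‖ * C) := by gcongr
    _ = _ := by ring

/-- Pulled back along A, the form is bounded on the whole space, and Riesz representation applies.
-/
theorem exists_operator_of_form {A : E →L[ℂ] E} (hA : Function.Injective A)
    {w : SesqForm (boundedInverse A).domain} {C : ℝ}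
    (hC : ∀ x y, ‖w x y‖ ≤ C * ‖boundedInverse A x‖ * ‖boundedInverse A y‖) :
    ∃ V : E →L[ℂ] E, ∀ x y, ⟪boundedInverse A y, V (boundedInverse A x)⟫_ℂ = w x y := by
  let j : E →ₗ[ℂ] (boundedInverse A).domain :=
    (A : E →ₗ[ℂ] E).codRestrict _ (mem_domain_boundedInverse hA)
  have hj : ∀ x, boundedInverse A (j x) = x := fun x => boundedInverse_apply hA x _
  have hj' : ∀ u, j (boundedInverse A u) = u := fun u => Subtype.ext (apply_boundedInverse hA u)
  let f : E →ₛₗ[starRingEnd ℂ] E →ₗ[ℂ] ℂ :=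
    LinearMap.mk₂'ₛₗ (starRingEnd ℂ) (RingHom.id ℂ) (fun y x => w (j x) (j y))
      (by intros; simp) (by intros; simp) (by intros; simp) (by intros; simp)
  let B : E →L⋆[ℂ] E →L[ℂ] ℂ := f.mkContinuous₂ C fun y x => by
    have h := hC (j x) (j y)
    rw [hj, hj] at h
    calc ‖w (j x) (j y)‖ ≤ _ := h
      _ = _ := by ring
  refine ⟨ContinuousLinearMap.adjoint (InnerProductSpace.continuousLinearMapOfBilin B),
    fun x y => ?_⟩
  rw [ContinuousLinearMap.adjoint_inner_right,
    InnerProductSpace.continuousLinearMapOfBilin_apply]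
  change w (j (boundedInverse A x)) (j (boundedInverse A y)) = w x y
  rw [hj', hj']

/-- For s² = ρ/(2 - 3ρ) one has (1 + s²)ρ = 2(1 - ρ)s², and s² ≤ s because s < 1. The latter is
equivalent to ρ < 1/2. -/
theorem sqrt_angle_estimates {ρ : ℝ} (hρ0 : 0 ≤ ρ) (hρ : ρ < 1 / 2) :
    Real.sqrt (ρ / (2 - 3 * ρ)) < 1 ∧ (1 + Real.sqrt (ρ / (2 - 3 * ρ)) ^ 2) * ρ ≤
      2 * (1 - ρ) * Real.sqrt (ρ / (2 - 3 * ρ)) := by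
  have hd : 0 < 2 - 3 * ρ := by linarith
  have hlt : Real.sqrt (ρ / (2 - 3 * ρ)) < 1 := by
    rw [Real.sqrt_lt' one_pos, one_pow, div_lt_one hd]
    linarith
  refine ⟨hlt, ?_⟩
  have hsq : Real.sqrt (ρ / (2 - 3 * ρ)) ^ 2 = ρ / (2 - 3 * ρ) := Real.sq_sqrt (by positivity)
  have hs0 := Real.sqrt_nonneg (ρ / (2 - 3 * ρ))
  have e : (1 + Real.sqrt (ρ / (2 - 3 * ρ)) ^ 2) * ρ =
      2 * (1 - ρ) * Real.sqrt (ρ / (2 - 3 * ρ)) ^ 2 := by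
    rw [hsq]
    linear_combination -(div_mul_cancel₀ ρ hd.ne')
  rw [e]
  refine mul_le_mul_of_nonneg_left ?_ (by linarith)
  nlinarith

end Translation

end FormPert

end

/-! ### Part: the theorem. -/

theorem theorem3p1 {E : Type*} [NormedAddCommGroup E] [InnerProductSpace ℂ E] [CompleteSpace E]
    (H₀ : E →ₗ.[ℂ] E) (hH₀ : IsSelfAdjoint H₀)
    (δ : ℝ) (hδ : 0 < δ)
    (hgap : ∀ t : ℝ, t ∈ Set.Ioo (-δ) δ → (t : ℂ) ∈ FormPert.resolventSet H₀)
    (D : Submodule ℂ E) (hD : (FormPert.absSqrt H₀).HasCore D)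
    (v : FormPert.SesqForm D)
    (hv : FormPert.formSup H₀ v Set.univ < 1)
    (ρ : ℝ≥0)
    (hρ_def : FormPert.formSup H₀ (FormPert.formExt (FormPert.absSqrt H₀) v)
      (((FormPert.posProj H₀).range : Set E) ∪ ((FormPert.negProj H₀).range : Set E)) = ρ)
    (hρ : (ρ : ℝ) < 1 / 2)
    (Pp Pm : E →L[ℂ] E) (hP : FormPert.IsComplementaryPair Pp Pm)
    (ν : ℝ) (hν_p : ‖FormPert.posProj H₀ - Pp‖ = ν) (hν_m : ‖FormPert.negProj H₀ - Pm‖ = ν)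
    (hν : ν < 1)
    (hangle : Real.arctan (Real.sqrt (ρ / (2 - 3 * ρ))) + Real.arcsin ν < Real.pi / 2) :
    ∃ H : E →ₗ.[ℂ] E,
      -- existence and uniqueness of the associated operator, and the core property
      FormPert.IsAssociated H
        (FormPert.freeForm H₀ + FormPert.formExt (FormPert.absSqrt H₀) v) ∧
      (∀ H' : E →ₗ.[ℂ] E, FormPert.IsAssociated H'
        (FormPert.freeForm H₀ + FormPert.formExt (FormPert.absSqrt H₀) v) → H' = H) ∧
      (FormPert.absSqrt H₀).HasCore H.domain ∧
      -- the decomposition and the separation of the spectrum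
      ∃ Qp Qm : E →L[ℂ] E,
        FormPert.IsDecomposedBy H Qp Qm ∧
        FormPert.spectrum (FormPert.part H Qp.range) =
          FormPert.spectrum H ∩ {z : ℂ | 0 < z.re} ∧
        FormPert.spectrum (FormPert.part H Qm.range) =
          FormPert.spectrum H ∩ {z : ℂ | z.re < 0} ∧
        -- the restrictions are isomorphisms, and the ranges are graphs
        ∃ (ep : Qp.range ≃L[ℂ] Pp.range) (em : Qm.range ≃L[ℂ] Pm.range),
          (ep : Qp.range →L[ℂ] Pp.range) = FormPert.restr Pp Qp.range ∧
          (em : Qm.range →L[ℂ] Pm.range) = FormPert.restr Pm Qm.range ∧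
          ∃ (Xp : Pp.range →L[ℂ] Pm.range) (Xm : Pm.range →L[ℂ] Pp.range),
            Xp = FormPert.restr Pm Qp.range ∘L (ep.symm : Pp.range →L[ℂ] Qp.range) ∧
            Xm = FormPert.restr Pp Qm.range ∘L (em.symm : Pm.range →L[ℂ] Qm.range) ∧
            (Qp.range : Set E) = {z | ∃ x : Pp.range, z = (x : E) + (Xp x : E)} ∧
            (Qm.range : Set E) = {z | ∃ y : Pm.range, z = (y : E) + (Xm y : E)} ∧
            ‖Xp‖ ≤ Real.tan (Real.arctan (Real.sqrt (ρ / (2 - 3 * ρ))) + Real.arcsin ν) ∧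
            ‖Xm‖ ≤ Real.tan (Real.arctan (Real.sqrt (ρ / (2 - 3 * ρ))) + Real.arcsin ν) := by
  open FormPert in
  have h0 : (0 : ℂ) ∈ resolventSet H₀ := by
    simpa using hgap 0 ⟨neg_lt_zero.2 hδ, hδ⟩
  have hR := isResolventAt_resolvent h0
  have hRs := isSelfAdjoint_of_isResolventAt_zero hH₀ hR
  have hAinj : Function.Injective (absInvSqrt H₀) :=
    sqrt_abs_injective hRs (injective_of_isResolventAt_zero hR)
  have hproj := isStarProjection_posProj H₀
  have hD' : (boundedInverse (absInvSqrt H₀)).HasCore D := hD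
  -- This bound makes `formExt` a genuine extension rather than its default value 0.
  have hvb : ∀ x y : D, ‖v x y‖ ≤ (1 : ℝ) * ‖absSqrt H₀ ⟨x, hD.le_domain x.2⟩‖ *
      ‖absSqrt H₀ ⟨y, hD.le_domain y.2⟩‖ := by
    intro x y
    have e : ∀ z : D, absInvSqrt H₀ (absSqrt H₀ ⟨z, hD.le_domain z.2⟩) = z := fun z =>
      apply_boundedInverse hAinj ⟨(z : E), hD'.le_domain z.2⟩
    have hmem : ∀ z : D, absInvSqrt H₀ (absSqrt H₀ ⟨z, hD.le_domain z.2⟩) ∈ D := fun z => by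
      rw [e]; exact z.2
    have h1 := norm_le_of_formSup_le (C := 1) (fun _ _ _ => Set.mem_univ _)
      (by simpa using hv.le) (Set.mem_univ _) (Set.mem_univ _) (hmem x) (hmem y)
    have e' : ∀ z : D, (⟨_, hmem z⟩ : D) = z := fun z => Subtype.ext (e z)
    rw [e', e'] at h1
    simpa using h1
  obtain ⟨-, C, hC⟩ := formExt_spec hD v 1 hvb
  obtain ⟨V, hV⟩ := exists_operator_of_form hAinj hC
  have hneg : ∀ x, negProj H₀ x = x - posProj H₀ x := fun x => rfl
  have hrange : ∀ x, (posProj H₀ x = x ∨ posProj H₀ x = 0) →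
      x ∈ (((posProj H₀).range : Set E) ∪ ((negProj H₀).range : Set E)) := by
    rintro x (hx | hx)
    · exact Or.inl ⟨x, hx⟩
    · refine Or.inr ⟨x, ?_⟩
      change negProj H₀ x = x
      rw [hneg, hx, sub_zero]
  have hM : ∀ c : ℂ, ∀ x ∈ (((posProj H₀).range : Set E) ∪ ((negProj H₀).range : Set E)),
      c • x ∈ (((posProj H₀).range : Set E) ∪ ((negProj H₀).range : Set E)) := by
    rintro c x (hx | hx)
    · exact Or.inl (Submodule.smul_mem _ c hx)
    · exact Or.inr (Submodule.smul_mem _ c hx)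
  have hsmall : IsBlockSmall (absInvSqrt H₀) (posProj H₀) V ρ :=
    { sa := sqrt_abs_isSelfAdjoint _
      inj := hAinj
      proj := hproj
      comm := commute_absInvSqrt_posProj hRs
      bound := fun x y hx hy => by
        have h1 := norm_le_of_formSup_le hM hρ_def.le (hrange y hy) (hrange x hx)
          (mem_domain_boundedInverse hAinj y) (mem_domain_boundedInverse hAinj x)
        have h2 := hV ⟨_, mem_domain_boundedInverse hAinj y⟩ ⟨_, mem_domain_boundedInverse hAinj x⟩
        rw [boundedInverse_apply hAinj, boundedInverse_apply hAinj] at h2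
        rw [h2]
        exact h1.trans_eq (by ring)
      nonneg := ρ.2
      lt_half := hρ }
  have hq : ∀ u w : (boundedInverse (absInvSqrt H₀)).domain,
      (freeForm H₀ + formExt (absSqrt H₀) v) u w = ⟪boundedInverse (absInvSqrt H₀) w,
        formOp (posProj H₀) V (boundedInverse (absInvSqrt H₀) u)⟫_ℂ := by
    intro u w
    have e : (freeForm H₀ + formExt (absSqrt H₀) v) u w =
      ⟪signOp H₀ (absSqrt H₀ w), absSqrt H₀ u⟫_ℂ + formExt (absSqrt H₀) v u w := rfl
    rw [e, signOp_eq, inner_weighted_left hproj]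
    exact (congrArg (_ + ·) (hV u w).symm).trans (inner_add_right _ _ _).symm
  obtain ⟨hs1, hs⟩ := sqrt_angle_estimates ρ.2 hρ
  have hs0 := Real.sqrt_nonneg ((ρ : ℝ) / (2 - 3 * ρ))
  obtain ⟨G, hG1, hGc, hGp, hGm⟩ := hsmall.exists_sign hs0 hs1 hs
  have hG : IsConeSign (posProj H₀) G (Real.sqrt (ρ / (2 - 3 * ρ))) := ⟨hG1, hGp, hGm⟩
  obtain ⟨hdec, hsp, hsm⟩ := hsmall.decomposition hs0 hs1 hG hGc
  obtain ⟨ep, hep, hgp, hnp⟩ := hG.exists_graph hproj hs0 hs1 hP.idem_p hP.add_eq hν_p hν hangle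
  -- The negative subspace is the positive one for -G and 1 - P, with the same s and ν.
  obtain ⟨em, hem, hgm, hnm⟩ := hG.swap.exists_graph hproj.one_sub hs0 hs1 hP.idem_m
    (by rw [add_comm]; exact hP.add_eq) hν_m hν hangle
  exact ⟨_, hsmall.isAssociated hq, fun H' hH' => hsmall.eq_of_isAssociated hq hH', hsmall.hasCore,
    signProj G, signProj (-G), hdec, hsp, hsm, ep, em, hep, hem, _, _, rfl, rfl, hgp, hgm, hnp, hnm⟩
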